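/- Let $\mathcal P$ be a finite triangulation in the plane with $n$ vertices, each triangle $f$ having a positive integral weight $w_f$; let $w_{\max},w_{\min}$ be the extreme weights, $\mu=w_{\max}/w_{\min}$, and $l_{\max},l_{\min}$ the extreme edge lengths. If faces $f,g$ share an edge and $w_f>w_g$, the critical angle for passing from $f$ to $g$ is $\arcsin(w_g/w_f)$; let $\theta_{cm}$ be the maximum of all critical angles ($0$ if there are none) and $\eta=2(1+1/\cos\theta_{cm})$. Fix a vertex $u$. A refracted ray from a point is a polygonal path that runs straight through the interiors of triangles and crosses edges at interior points of these edges, obeying Snell's law there and with angle of incidence less than the critical angle (if there is one). The edges it crosses form its edge sequence. The sources of the tree of rays $\mathcal T_R(u)$ are $u$ and, inductively, the critical sources: the points at which a ray initiated from a source of the tree strikes an edge $e$, coming from a face $f$, exactly at the critical angle of $e$; from a critical source, rays go to the other side of $e$. From each source a finite set of rays (given by their directions) is initiated; these are the rays of $\mathcal T_R(u)$. A Type-I ray from $u$ is a refracted ray with arbitrary direction issued from a source of $\mathcal T_R(u)$ (so it uses no critical segment). The weighted distance $d(u,x)$ of a point $x$ along a ray is the weighted length of the path in the tree from $u$ to the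 source of the ray plus that of the ray from its source to $x$, where a segment in face $f$ of length $\ell$ has weighted length $\ell\,w_f$. Let $0<\varepsilon'\le \dfrac{l_{\min}}{4\,n\,w_{\max}\,l_{\max}}$, and let $B$ be a bundle: a set of traced rays of $\mathcal T_R(u)$ such that of the edge sequences of any two of them one is a suffix of the other. Assume that * the edge sequences of the rays in $B$ have at most $n^2$ edges; * whenever a ray in $B$ crosses an edge that has a critical angle $\theta_c$ for this crossing, its angle of incidence is at most $\theta_c-\varepsilon'$; * any two successive rays in $B$ (rays from the same source into the same face, with no initiated ray from that source between them) make an angle of at most $\frac{1}{2\mu}(\varepsilon')^{n^2}\varepsilon'$ at their source. Let $r$ be a Type-I ray that reaches a point $v$ of an edge $e$, at weighted distance $d(u,v)$ along $r$, and that lies (weakly) between two successive rays $\rho_1,\rho_2\in B$ with the same source as $r$. 1. Suppose that $v$ is not a vertex and that $\rho_1$ and $\rho_2$, too, begin by traversing the faces that $r$ traverses on its way to $v$, crossing the same edges, and then strike $e$. Then some traced ray of $B$, having traversed the same faces, is incident onto $e$ at a point $v'$ with $d(u,v')\le d(u,v)(1+\eta\varepsilon')$. 2. Suppose that $v$ is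 a vertex and that $\rho_1$ and $\rho_2$, too, begin by traversing the faces that $r$ traverses on its way to $v$ (they may leave the last of these through different edges). Then some traced ray of $B$, having traversed the same faces, is incident onto an edge incident to $v$ at a point $v'$ with $d(u,v')\le d(u,v)(1+\eta\varepsilon')$. -/

import Mathlib

/-- The Euclidean plane. -/
abbrev Plane := EuclideanSpace ℝ (Fin 2)

/-- A finite triangulation in the plane in which every triangular face carries a positive integral
weight.  Faces of the complex are given by their vertex sets: triangles have three vertices, edges
two; every vertex and every edge belongs to a triangle. -/
structure WeightedTriangulation extends Geometry.SimplicialComplex ℝ Plane where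
  finite_faces : faces.Finite
  pure : ∀ s ∈ faces, ∃ t ∈ faces, s ⊆ t ∧ t.card = 3
  weight : Finset Plane → ℕ
  weight_pos : ∀ t ∈ faces, t.card = 3 → 0 < weight t

namespace WeightedTriangulation

variable (T : WeightedTriangulation)

/-- The vertices of the triangulation. -/
def verts : Set Plane := {v | {v} ∈ T.faces}

/-- The edges of the triangulation. -/
def edges : Set (Finset Plane) := {e | e ∈ T.faces ∧ e.card = 2}

/-- The triangular faces of the triangulation. -/
def triangles : Set (Finset Plane) := {t | t ∈ T.faces ∧ t.card = 3}

/-- The number `n` of vertices. -/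
noncomputable def n : ℕ := T.verts.ncard

/-- The largest weight of a triangle. -/
noncomputable def wMax : ℕ := sSup (T.weight '' T.triangles)

/-- The smallest weight of a triangle. -/
noncomputable def wMin : ℕ := sInf (T.weight '' T.triangles)

/-- The ratio `μ` of the largest to the smallest weight. -/
noncomputable def mu : ℝ := (T.wMax : ℝ) / T.wMin

/-- The set of lengths of edges. -/
def edgeLengths : Set ℝ := {l | ∃ a b, a ≠ b ∧ {a, b} ∈ T.edges ∧ l = dist a b}

/-- The length of a longest edge. -/
noncomputable def lMax : ℝ := sSup T.edgeLengths

/-- The length of a shortest edge. -/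
noncomputable def lMin : ℝ := sInf T.edgeLengths

/-- The critical angle for passing from face `f` to face `g`; meaningful when
`T.weight g < T.weight f`. -/
noncomputable def criticalAngle (f g : Finset Plane) : ℝ :=
  Real.arcsin ((T.weight g : ℝ) / T.weight f)

/-- The maximum `θ_cm` of the critical angles at the edges of the triangulation (`0` if no edge has
a critical angle, that is, if any two faces that share an edge have the same weight). -/
noncomputable def maxCriticalAngle : ℝ :=
  sSup ({0} ∪ {θ | ∃ f ∈ T.triangles, ∃ g ∈ T.triangles, ∃ e ∈ T.edges, e ⊆ f ∧ e ⊆ g ∧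
    T.weight g < T.weight f ∧ θ = T.criticalAngle f g})

/-- `η = 2 (1 + 1 / cos θ_cm)`. -/
noncomputable def eta : ℝ := 2 * (1 + 1 / Real.cos T.maxCriticalAngle)

end WeightedTriangulation

/-- The points of an edge other than its endpoints. -/
def edgeInterior (e : Finset Plane) : Set Plane :=
  {p | ∃ a b, a ≠ b ∧ e = {a, b} ∧ p ∈ openSegment ℝ a b}

/-- The unit vector pointing from `p` to `q`. -/
noncomputable def unitVec (p q : Plane) : Plane := ‖q - p‖⁻¹ • (q - p)

/-- The component along the line of the edge `e` of the vector `d`.  If `d` is a unit vector, then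
the length of this component is the sine of the (acute) angle between `d` and the normal of `e`. -/
noncomputable def alongEdge (e : Finset Plane) (d : Plane) : Plane :=
  (vectorSpan ℝ (e : Set Plane)).starProjection d

/-- The angle between the normal of `e` and the segment from `p` to `q`, for `q` on `e`: the angle
of incidence. -/
noncomputable def incidenceAngle (e : Finset Plane) (p q : Plane) : ℝ :=
  Real.arcsin ‖alongEdge e (unitVec p q)‖

/-- One step of a ray: the ray runs through the triangle `face` and strikes the edge `edge` of this
triangle at the point `pt`. -/
structure Strike where
  face : Finset Plane
  edge : Finset Plane
  pt : Plane

/-- A ray located at `o` runs straight through the interior of a triangle and strikes an edge. -/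
def Strikes (T : WeightedTriangulation) (o : Plane) (s : Strike) : Prop :=
  s.face ∈ T.triangles ∧ s.edge ∈ T.edges ∧ s.edge ⊆ s.face ∧
  o ∈ convexHull ℝ (s.face : Set Plane) ∧ s.pt ∈ convexHull ℝ (s.edge : Set Plane) ∧
  openSegment ℝ o s.pt ⊆ interior (convexHull ℝ (s.face : Set Plane))

/-- A ray that came from `o` to its strike `s` crosses the struck edge at an interior point of that
edge into the face on the other side and proceeds to the strike `s'`: the angle of incidence is less
than the critical angle (if there is one), and Snell's law holds (for the components along the edge
of the unit directions, so that it fixes the sides of the normal as well as the two angles). -/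
def Refracts (T : WeightedTriangulation) (o : Plane) (s s' : Strike) : Prop :=
  s.pt ∈ edgeInterior s.edge ∧ s'.face ≠ s.face ∧ s.edge ⊆ s'.face ∧
  (T.weight s'.face < T.weight s.face →
    incidenceAngle s.edge o s.pt < T.criticalAngle s.face s'.face) ∧
  (T.weight s.face : ℝ) • alongEdge s.edge (unitVec o s.pt) =
    (T.weight s'.face : ℝ) • alongEdge s.edge (unitVec s.pt s'.pt)

/-- The successive strikes of a ray that starts at `o`.  All struck edges but the last are crossed
with refraction. -/
def IsRefractedPath (T : WeightedTriangulation) : Plane → List Strike → Prop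
  | _, [] => True
  | o, [s] => Strikes T o s
  | o, s :: s' :: L => Strikes T o s ∧ Refracts T o s s' ∧ IsRefractedPath T s.pt (s' :: L)

/-- At every crossed edge that has a critical angle `θ_c`, the angle of incidence is at most
`θ_c - κ`. -/
def AvoidsCritical (T : WeightedTriangulation) (κ : ℝ) : Plane → List Strike → Prop
  | _, [] => True
  | _, [_] => True
  | o, s :: s' :: L =>
    (T.weight s'.face < T.weight s.face →
      incidenceAngle s.edge o s.pt ≤ T.criticalAngle s.face s'.face - κ) ∧
    AvoidsCritical T κ s.pt (s' :: L)

/-- The weighted Euclidean length of the path from `o` through the given strikes. -/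
noncomputable def pathCost (T : WeightedTriangulation) : Plane → List Strike → ℝ
  | _, [] => 0
  | o, s :: L => T.weight s.face * dist o s.pt + pathCost T s.pt L

/-- The point at which the path from `o` through the given strikes ends. -/
def endPoint (o : Plane) (L : List Strike) : Plane := L.foldl (fun _ s => s.pt) o

/-- A point from which rays are issued: its location, the weighted length of the path in the tree of
rays that leads to it, and, if it is a critical source, the face from which it was struck. -/
structure Source where
  pt : Plane
  cost : ℝ
  behind : Option (Finset Plane)

/-- A ray: its source, and its strikes as far as it has been traced. -/
structure Ray where
  source : Source
  path : List Strike

namespace Ray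

/-- The direction in which a ray leaves its source. -/
noncomputable def dir (r : Ray) : Plane :=
  match r.path with
  | [] => 0
  | s :: _ => unitVec r.source.pt s.pt

/-- The edge sequence of a ray: the edges that it crosses.  (The last edge that it strikes is not
yet crossed.) -/
def edgeSeq (r : Ray) : List (Finset Plane) := r.path.dropLast.map Strike.edge

/-- The faces traversed by a ray. -/
def faceSeq (r : Ray) : List (Finset Plane) := r.path.map Strike.face

/-- The faces traversed by a ray, each with the edge that the ray strikes at the end of it. -/
def track (r : Ray) : List (Finset Plane × Finset Plane) :=
  r.path.map fun s => (s.face, s.edge)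

/-- The weighted distance, from the root of the tree of rays, of the point to which the ray has been
traced. -/
noncomputable def cost (T : WeightedTriangulation) (r : Ray) : ℝ :=
  r.source.cost + pathCost T r.source.pt r.path

/-- The ray ends (as far as it is given) by striking the edge `e` at the point `v`. -/
def EndsAt (r : Ray) (e : Finset Plane) (v : Plane) : Prop :=
  ∃ L s, r.path = L ++ [s] ∧ s.edge = e ∧ s.pt = v

/-- The traced ray `r` is incident onto the edge `e` at the point `v` when it has traversed exactly
the faces `fs`, and `d` is the weighted distance of `v` along `r` from the root of the tree of
rays. -/
def IncidentAt (T : WeightedTriangulation) (r : Ray) (fs : List (Finset Plane))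
    (e : Finset Plane) (v : Plane) (d : ℝ) : Prop :=
  ∃ L, L <+: r.path ∧ (Ray.mk r.source L).faceSeq = fs ∧ (Ray.mk r.source L).EndsAt e v ∧
    d = (Ray.mk r.source L).cost T

end Ray

/-- `r` consists of one or more segments, leaves its source in an admissible way (from a critical
source it leaves to the side opposite to the one from which the source was struck), and is refracted
at all the edges that it crosses. -/
def IsRayFrom (T : WeightedTriangulation) (σ : Source) (r : Ray) : Prop :=
  r.source = σ ∧ r.path ≠ [] ∧ IsRefractedPath T σ.pt r.path ∧
  ∀ s L, r.path = s :: L → σ.behind ≠ some s.face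

/-- The sources in the tree of rays of the vertex `u`, where `R σ` is the finite set of the
directions of the rays that are initiated from the source `σ`: the vertex `u` itself, and, for every
initiated ray of a source `σ` in the tree that strikes an edge at the critical angle, the point of
critical incidence.  (Rays from the critical source are Steiner rays; no critical segment is used.)
-/
inductive IsSource (T : WeightedTriangulation) (u : Plane) (R : Source → Finset Plane) :
    Source → Prop
  | root : IsSource T u R ⟨u, 0, none⟩
  | critical (σ : Source) (L : List Strike) (s : Strike) (g : Finset Plane)
      (hσ : IsSource T u R σ)
      (hray : IsRayFrom T σ ⟨σ, L ++ [s]⟩)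
      (hdir : (Ray.mk σ (L ++ [s])).dir ∈ R σ)
      (hpt : s.pt ∈ edgeInterior s.edge)
      (hg : g ∈ T.triangles) (hne : g ≠ s.face) (he : s.edge ⊆ g)
      (hw : T.weight g < T.weight s.face)
      (hcrit : incidenceAngle s.edge (endPoint σ.pt L) s.pt = T.criticalAngle s.face g) :
      IsSource T u R ⟨s.pt, (Ray.mk σ (L ++ [s])).cost T, some s.face⟩

/-- A Type-I ray from `u`: it runs from `u`, possibly through critical sources of the tree of rays
of `u`, and is refracted at the edges that it crosses; it uses no critical segment.  Its direction
at its source is arbitrary. -/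
def IsTypeIRay (T : WeightedTriangulation) (u : Plane) (R : Source → Finset Plane) (r : Ray) :
    Prop :=
  IsSource T u R r.source ∧ IsRayFrom T r.source r

/-- A ray of the tree of rays of `u`: a Type-I ray that has one of the finitely many initiated
directions. -/
def IsTreeRay (T : WeightedTriangulation) (u : Plane) (R : Source → Finset Plane) (r : Ray) :
    Prop :=
  IsTypeIRay T u R r ∧ r.dir ∈ R r.source

/-- A bundle of rays of the tree of rays of `u`: any two of its rays are siblings, that is, the edge
sequence of one of them is a suffix of the edge sequence of the other.  Maximality is not
demanded, so that the bundles into which a bundle is split are included too. -/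
def IsRayBundle (T : WeightedTriangulation) (u : Plane) (R : Source → Finset Plane) (B : Set Ray) :
    Prop :=
  (∀ r ∈ B, IsTreeRay T u R r) ∧
  ∀ r₁ ∈ B, ∀ r₂ ∈ B, r₁.edgeSeq <:+ r₂.edgeSeq ∨ r₂.edgeSeq <:+ r₁.edgeSeq

/-- The cone of nonnegative combinations of two directions. -/
def cone (d₁ d₂ : Plane) : Set Plane :=
  {d | ∃ a b : ℝ, 0 ≤ a ∧ 0 ≤ b ∧ d = a • d₁ + b • d₂}

/-- Two rays with the same source are successive: they enter the same face, and no other ray that is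
initiated from the source runs between them. -/
def Successive (R : Source → Finset Plane) (r₁ r₂ : Ray) : Prop :=
  r₁.source = r₂.source ∧ r₁.faceSeq.head? = r₂.faceSeq.head? ∧
  ∀ d ∈ R r₁.source, d ∈ cone r₁.dir r₂.dir → d = r₁.dir ∨ d = r₂.dir

/-- In the angular order around the common source, `r` lies (weakly) between `r₁` and `r₂`. -/
def LiesBetween (r₁ r₂ r : Ray) : Prop :=
  r.source = r₁.source ∧ r.source = r₂.source ∧ r.dir ∈ cone r₁.dir r₂.dir

/-! The inner ray `r` calibrates its neighbours. Let d_i be its unit direction in the i-th face and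
w_i the weight there. By Snell's law w_i d_i and w_{i+1} d_{i+1} have the same component along the
edge between the two faces. So for another ray ρ from the same source through the same faces, the
sum of the products of w_i d_i with the i-th segment of ρ telescopes to the weighted length of `r`
plus one end term w d · (v' - v), with w and d taken in the last face (`cost_step`, `cost_last`).
The same sum is the weighted length of ρ with each segment multiplied by the cosine of its angle
with d_i. Hence, if the end term is nonpositive, ρ exceeds `r` by at most the factor 1 / min cos.

The end term is governed by planar order. Refraction keeps the three rays in order and diverging
(`LeftOf`), so the outer ones end on either side of `r`, and at least one end does not lie beyond v
in the direction of `r` (`dot_nonpos_of_edge_eq`, `dot_nonpos_of_vertex`).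

The cosines are governed by half angles. The tangent of half the angle between two directions is the
difference of their sines over the sum of their cosines, relative to the normal of the crossed edge.
Snell's law multiplies the numerator by w / w'. Staying ε' away from the critical angle keeps each
refracted cosine at least ε' w / w' times the old one (`le_cos_sq_refract_of_le_critical`). The
tangent therefore grows at most by 1 / ε' per crossing (`half_angle_refract`); `r` inherits the
cosine bound because its sine lies between those of the outer rays. From at most (ε' / 2) ε'^(n²),
the tangent stays below ε' / 2 through n² crossings. So every cosine is at least 1 - ε'² / 2, and
its reciprocal is at most 1 + 2ε' ≤ 1 + ηε'. -/

/-! ### Coordinates along a line and its normal -/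

/-- The standard inner product of the plane, in coordinates. -/
def dot (x y : Plane) : ℝ := x 0 * y 0 + x 1 * y 1

/-- The signed area of the parallelogram spanned by two vectors. -/
def cross (x y : Plane) : ℝ := x 0 * y 1 - x 1 * y 0

/-- Rotation by a right angle. -/
noncomputable def perp (x : Plane) : Plane := !₂[-x 1, x 0]

lemma inner_eq_dot (x y : Plane) : inner ℝ x y = dot x y := by
  simp [dot, EuclideanSpace.inner_eq_star_dotProduct, dotProduct, Fin.sum_univ_two, mul_comm]

lemma norm_sq_eq_dot (x : Plane) : ‖x‖ ^ 2 = dot x x := by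
  rw [← inner_eq_dot, real_inner_self_eq_norm_sq]

lemma plane_ext {x y : Plane} (h0 : x 0 = y 0) (h1 : x 1 = y 1) : x = y := by
  ext i; fin_cases i <;> assumption

lemma dot_perp_perp (ν : Plane) : dot (perp ν) (perp ν) = dot ν ν := by
  simp [dot, perp]; ring

lemma cross_eq_frame {ν : Plane} (hν : dot ν ν = 1) (x y : Plane) :
    cross x y = dot ν x * dot (perp ν) y - dot (perp ν) x * dot ν y := by
  simp only [dot, perp, cross] at *
  simp
  linear_combination (-(x 0 * y 1 - x 1 * y 0)) * hν

lemma dot_eq_frame {ν : Plane} (hν : dot ν ν = 1) (x y : Plane) :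
    dot x y = dot (perp ν) x * dot (perp ν) y + dot ν x * dot ν y := by
  simp only [dot, perp] at *
  simp
  linear_combination (-(x 0 * y 0 + x 1 * y 1)) * hν

lemma eq_frame {ν : Plane} (hν : dot ν ν = 1) (x : Plane) :
    x = dot (perp ν) x • perp ν + dot ν x • ν := by
  simp only [dot, perp] at *
  apply plane_ext <;> simp
  · linear_combination (-(x 0)) * hν
  · linear_combination (-(x 1)) * hν

lemma dot_add_right (x y z : Plane) : dot x (y + z) = dot x y + dot x z := by
  simp [dot]; ring

lemma dot_sub_right (x y z : Plane) : dot x (y - z) = dot x y - dot x z := by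
  simp [dot]; ring

lemma dot_smul_right (a : ℝ) (x y : Plane) : dot x (a • y) = a * dot x y := by
  simp [dot]; ring

lemma dot_smul_left (a : ℝ) (x y : Plane) : dot (a • x) y = a * dot x y := by
  simp [dot]; ring

lemma dot_comm (x y : Plane) : dot x y = dot y x := by
  simp [dot]; ring

lemma dot_le_one {x y : Plane} (hx : dot x x = 1) (hy : dot y y = 1) : dot x y ≤ 1 := by
  simp only [dot] at *
  nlinarith [sq_nonneg (x 0 - y 0), sq_nonneg (x 1 - y 1)]

lemma isLinearMap_dot (ν : Plane) : IsLinearMap ℝ (dot ν) :=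
  ⟨dot_add_right ν, fun a x => by simp [dot_smul_right]⟩

lemma dot_unitVec_self {p q : Plane} (h : p ≠ q) : dot (unitVec p q) (unitVec p q) = 1 := by
  have : ‖q - p‖ ≠ 0 := by rw [norm_ne_zero_iff, sub_ne_zero]; exact h.symm
  rw [← norm_sq_eq_dot, unitVec, norm_smul, norm_inv, norm_norm, inv_mul_cancel₀ this, one_pow]

lemma dist_smul_unitVec {p q : Plane} (h : p ≠ q) : q - p = dist p q • unitVec p q := by
  have : ‖q - p‖ ≠ 0 := by rw [norm_ne_zero_iff, sub_ne_zero]; exact h.symm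
  rw [unitVec, dist_comm, dist_eq_norm, smul_smul, mul_inv_cancel₀ this, one_smul]

/-! ### Refraction of two rays at a line -/

section Refraction

variable {ν a b a' b' : Plane} {w w' ε M : ℝ}

/-- The components of a unit vector along a line and its normal are a sine and a cosine. -/
lemma sin_sq_add_cos_sq (hν : dot ν ν = 1) (ha : dot a a = 1) :
    dot (perp ν) a ^ 2 + dot ν a ^ 2 = 1 := by
  rw [dot_eq_frame hν] at ha; linarith

/-- Both directions cross the line to the same side, where the sine of the angle to the normal is
monotone in the angle. Angular order thus becomes an inequality between tangential components, the
quantities that Snell's law controls. -/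
lemma cross_nonneg_iff (hν : dot ν ν = 1) (ha : dot a a = 1) (hb : dot b b = 1)
    (hca : 0 < dot ν a) (hcb : 0 < dot ν b) :
    0 ≤ cross a b ↔ dot (perp ν) a ≤ dot (perp ν) b := by
  rw [cross_eq_frame hν]
  have h1 := sin_sq_add_cos_sq hν ha
  have h2 := sin_sq_add_cos_sq hν hb
  generalize dot (perp ν) a = s at *
  generalize dot (perp ν) b = t at *
  generalize dot ν a = c at *
  generalize dot ν b = d at *
  -- For angles α, β to the normal: sin(β - α)(cos α + cos β) = (sin β - sin α)(1 + cos(β - α)).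
  have key : (c * t - s * d) * (c + d) = (t - s) * (1 + s * t + c * d) := by
    linear_combination t * h1 - s * h2
  have hpos : 0 < 1 + s * t + c * d := by nlinarith [sq_nonneg (s + t), mul_pos hca hcb]
  constructor
  · intro h
    by_contra! hlt
    have := mul_neg_of_neg_of_pos (sub_neg.2 hlt) hpos
    have := mul_nonneg h (add_pos hca hcb).le
    linarith
  · intro h
    by_contra! hlt
    have := mul_neg_of_neg_of_pos hlt (add_pos hca hcb)
    have := mul_nonneg (sub_nonneg.2 h) hpos.le
    linarith

/-- Snell's law multiplies both sines by the same positive factor, so it preserves their order. -/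
lemma cross_refract_nonneg (hν : dot ν ν = 1) (ha : dot a a = 1) (hb : dot b b = 1)
    (ha' : dot a' a' = 1) (hb' : dot b' b' = 1)
    (hca : 0 < dot ν a) (hcb : 0 < dot ν b) (hca' : 0 < dot ν a') (hcb' : 0 < dot ν b')
    (hw : 0 < w) (hw' : 0 < w')
    (hsa : w * dot (perp ν) a = w' * dot (perp ν) a')
    (hsb : w * dot (perp ν) b = w' * dot (perp ν) b') (h : 0 ≤ cross a b) :
    0 ≤ cross a' b' := by
  rw [cross_nonneg_iff hν ha hb hca hcb] at h
  rw [cross_nonneg_iff hν ha' hb' hca' hcb']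
  have := mul_le_mul_of_nonneg_left h hw.le
  rw [hsa, hsb] at this
  exact le_of_mul_le_mul_left this hw'

/-- For `x` along the line, the side of `x` seen from a direction that crosses the line depends only
on the orientation of `x`, not on that direction. -/
lemma cross_transfer {x : Plane} (hν : dot ν ν = 1) (hx : dot ν x = 0)
    (hca : 0 < dot ν a) (hca' : 0 < dot ν a') (h : 0 ≤ cross a x) : 0 ≤ cross a' x := by
  rw [cross_eq_frame hν, hx, mul_zero, sub_zero] at *
  exact mul_nonneg hca'.le (nonneg_of_mul_nonneg_right h hca)

/-- The square of the tangent of half the angle between two unit vectors. -/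
lemma one_sub_dot_mul (hν : dot ν ν = 1) (ha : dot a a = 1) (hb : dot b b = 1) :
    (1 - dot a b) * (dot ν a + dot ν b) ^ 2 =
      (dot (perp ν) a - dot (perp ν) b) ^ 2 * (1 + dot a b) := by
  rw [dot_eq_frame hν a b]
  have h1 := sin_sq_add_cos_sq hν ha
  have h2 := sin_sq_add_cos_sq hν hb
  generalize dot (perp ν) a = s at *
  generalize dot (perp ν) b = t at *
  generalize dot ν a = c at *
  generalize dot ν b = d at *
  have hc : c ^ 2 = 1 - s ^ 2 := by linarith
  have hd : d ^ 2 = 1 - t ^ 2 := by linarith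
  linear_combination (1 - s * t - c * d - 2 * d * d) * hc + (1 - s * t - c * d - 2 * (1 - s^2)) * hd

/-- By `one_sub_dot_mul` the half-angle tangent is |s - t| / (c + d). Refraction scales the
numerator by w / w', and `hga`, `hgb` say that the denominator shrinks at most to ε w / w' of
itself. -/
lemma half_angle_refract (hν : dot ν ν = 1) (ha : dot a a = 1) (hb : dot b b = 1)
    (ha' : dot a' a' = 1) (hb' : dot b' b' = 1)
    (hca : 0 < dot ν a) (hcb : 0 < dot ν b) (hca' : 0 < dot ν a') (hcb' : 0 < dot ν b')
    (hw : 0 < w) (hw' : 0 < w') (hε : 0 < ε)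
    (hsa : w * dot (perp ν) a = w' * dot (perp ν) a')
    (hsb : w * dot (perp ν) b = w' * dot (perp ν) b')
    (hga : ε * w * dot ν a ≤ w' * dot ν a') (hgb : ε * w * dot ν b ≤ w' * dot ν b')
    (h : 1 - dot a b ≤ M ^ 2 * (1 + dot a b)) :
    1 - dot a' b' ≤ (M / ε) ^ 2 * (1 + dot a' b') := by
  have e1 := one_sub_dot_mul hν ha hb
  have e2 := one_sub_dot_mul hν ha' hb'
  have pos : ∀ {x y : Plane}, dot x x = 1 → dot y y = 1 → 0 < dot ν x → 0 < dot ν y →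
      0 < 1 + dot x y := by
    intro x y hx hy h1 h2
    rw [dot_eq_frame hν x y]
    nlinarith [sq_nonneg (dot (perp ν) x + dot (perp ν) y), mul_pos h1 h2,
      sin_sq_add_cos_sq hν hx, sin_sq_add_cos_sq hν hy, mul_pos h1 h1, mul_pos h2 h2]
  have p1 := pos ha hb hca hcb
  have p2 := pos ha' hb' hca' hcb'
  generalize dot (perp ν) a = s at *
  generalize dot (perp ν) b = t at *
  generalize dot ν a = c at *
  generalize dot ν b = d at *
  generalize dot (perp ν) a' = s' at *
  generalize dot (perp ν) b' = t' at *
  generalize dot ν a' = c' at *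
  generalize dot ν b' = d' at *
  generalize dot a b = k at *
  generalize dot a' b' = k' at *
  -- the tangent of the half angle before refraction
  have t1 : (s - t) ^ 2 ≤ M ^ 2 * (c + d) ^ 2 := by
    refine le_of_mul_le_mul_right ?_ p1
    calc (s - t) ^ 2 * (1 + k) = (1 - k) * (c + d) ^ 2 := e1.symm
      _ ≤ M ^ 2 * (1 + k) * (c + d) ^ 2 := mul_le_mul_of_nonneg_right h (sq_nonneg _)
      _ = _ := by ring
  have t2 : (w' * (s' - t')) ^ 2 * ε ^ 2 ≤ M ^ 2 * (w' * (c' + d')) ^ 2 := by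
    have hs : w' * (s' - t') = w * (s - t) := by linarith
    have hc : 0 ≤ ε * w * (c + d) := by positivity
    have hcc : ε * w * (c + d) ≤ w' * (c' + d') := by linarith
    have : (ε * w * (c + d)) ^ 2 ≤ (w' * (c' + d')) ^ 2 := by gcongr
    calc (w' * (s' - t')) ^ 2 * ε ^ 2 = (s - t) ^ 2 * (w * ε) ^ 2 := by rw [hs]; ring
      _ ≤ M ^ 2 * (c + d) ^ 2 * (w * ε) ^ 2 := by gcongr
      _ = M ^ 2 * (ε * w * (c + d)) ^ 2 := by ring
      _ ≤ _ := by gcongr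
  have t3 : (s' - t') ^ 2 ≤ (M / ε) ^ 2 * (c' + d') ^ 2 := by
    rw [div_pow, div_mul_eq_mul_div, le_div_iff₀ (by positivity)]
    refine le_of_mul_le_mul_left ?_ (by positivity : 0 < w' ^ 2)
    calc _ = (w' * (s' - t')) ^ 2 * ε ^ 2 := by ring
      _ ≤ _ := t2
      _ = _ := by ring
  refine le_of_mul_le_mul_right ?_ (by positivity : 0 < (c' + d') ^ 2)
  calc _ = _ := e2
    _ ≤ (M / ε) ^ 2 * (c' + d') ^ 2 * (1 + k') := by gcongr
    _ = _ := by ring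

end Refraction

/-! ### Distance from the critical angle -/

/-- Away from the critical angle, refraction expands angles by a factor of at most `1 / ε`. -/
lemma le_cos_sq_refract_of_le_critical {s w w' W ε : ℝ} (hs : 0 ≤ s) (hs1 : s ≤ 1) (hw' : 1 ≤ w')
    (hww : w' < w) (hwW : w ≤ W) (hε : 0 < ε) (hεW : 4 * ε * W ≤ 1)
    (h : Real.arcsin s ≤ Real.arcsin (w' / w) - ε) :
    ε ^ 2 * w ^ 2 * (1 - s ^ 2) ≤ w' ^ 2 - w ^ 2 * s ^ 2 := by
  have hw : 0 < w := by linarith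
  set k := w' / w with hk
  have hk1 : k < 1 := by rw [hk, div_lt_one hw]; exact hww
  have hkε : 4 * ε ≤ k := by
    rw [hk, le_div_iff₀ hw]
    have : 4 * ε * w ≤ 4 * ε * W := by gcongr
    linarith
  have hε1 : ε ≤ 1 / 4 := by linarith
  have hsin : Real.sin (Real.arcsin k) = k := Real.sin_arcsin (by linarith) hk1.le
  have hK0 : 0 ≤ Real.cos (Real.arcsin k) := Real.cos_arcsin_nonneg k
  have hsK := Real.sin_sq_add_cos_sq (Real.arcsin k)
  rw [hsin] at hsK
  have hse : s ≤ k * Real.cos ε - Real.cos (Real.arcsin k) * Real.sin ε := by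
    have hsub := Real.sin_sub (Real.arcsin k) ε
    rw [hsin] at hsub
    rw [← hsub, ← Real.arcsin_le_iff_le_sin ⟨by linarith, hs1⟩]
    · exact h
    · constructor
      · have := Real.arcsin_nonneg.2 hs; linarith [Real.pi_pos]
      · linarith [Real.arcsin_le_pi_div_two k]
  have he := Real.sin_sq_add_cos_sq ε
  have hσ : ε - ε ^ 3 / 6 < Real.sin ε := Real.sin_gt_sub_cube hε
  have hσ0 : 0 < Real.sin ε := Real.sin_pos_of_pos_of_lt_pi hε (by linarith [Real.pi_gt_three])
  have hcε : 1 - ε ^ 2 / 2 ≤ Real.cos ε := Real.one_sub_sq_div_two_le_cos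
  have hcε1 := Real.cos_le_one ε
  generalize Real.cos (Real.arcsin k) = K at *
  generalize Real.sin ε = σ at *
  generalize Real.cos ε = γ at *
  -- `φ` and `C` are the sine and cosine of the critical angle minus ε; `k` and `K` are those of the
  -- critical angle.
  set φ := k * γ - K * σ with hφ
  set C := K * γ + k * σ with hC
  have hφC : φ ^ 2 + C ^ 2 = 1 := by
    rw [hφ, hC]; linear_combination hsK + (k ^ 2 + K ^ 2) * he
  have hε2 : ε ^ 2 ≤ 1 := pow_le_one₀ hε.le (by linarith)
  have hγ : 0 < γ := by linarith
  have hC0 : 0 < C := by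
    have : 0 < k * σ := mul_pos (by linarith) hσ0
    have := mul_nonneg hK0 hγ.le
    linarith
  have hC1 : C ≤ 1 := (sq_le_one_iff₀ hC0.le).1 (by linarith [sq_nonneg φ])
  have hK1 : K ≤ 1 := (sq_le_one_iff₀ hK0).1 (by linarith [sq_nonneg k])
  -- Backing off by ε raises the cosine to first order by k ε; the second-order loss K(1 - cos ε) ≤
  -- ε² / 2 is absorbed because ε ≤ k / 4.
  have hCK : k * ε / 2 ≤ C - K := by
    have h1 : K * (1 - γ) ≤ 1 * (ε ^ 2 / 2) :=
      mul_le_mul hK1 (by linarith) (by linarith) zero_le_one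
    have h2 : k * (ε - ε ^ 3 / 6) ≤ k * σ := mul_le_mul_of_nonneg_left hσ.le (by linarith)
    have h3 : ε * (4 * ε) ≤ ε * k := mul_le_mul_of_nonneg_left hkε hε.le
    have h4 : k * ε * ε ^ 2 ≤ k * ε * 1 := by
      apply mul_le_mul_of_nonneg_left hε2
      exact mul_nonneg (by linarith) hε.le
    have h5 : C - K = k * σ - K * (1 - γ) := by rw [hC]; ring
    rw [h5]
    linarith
  have hmain : ε ^ 2 * C ^ 2 ≤ (C - K) * (C + K) := by
    have h1 : ε * C ≤ ε * 1 := mul_le_mul_of_nonneg_left hC1 hε.le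
    replace h1 : ε * C ≤ k / 2 := by linarith
    calc ε ^ 2 * C ^ 2 = (ε * C) * (ε * C) := by ring
      _ ≤ (k / 2) * (ε * C) := by gcongr
      _ = (k * ε / 2) * C := by ring
      _ ≤ (C - K) * (C + K) := by
        apply mul_le_mul hCK (by linarith) hC0.le
        have : 0 ≤ k * ε / 2 := by positivity
        linarith
  have hs2 : s ^ 2 ≤ φ ^ 2 := by gcongr
  -- The case s = φ is `hmain`. The inequality only weakens as s² decreases, since its coefficient 1
  -- - ε² is nonnegative.
  have hfin : ε ^ 2 * (1 - s ^ 2) ≤ k ^ 2 - s ^ 2 := by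
    have : (1 - ε ^ 2) * s ^ 2 ≤ (1 - ε ^ 2) * φ ^ 2 :=
      mul_le_mul_of_nonneg_left hs2 (by linarith)
    have h2 : ε ^ 2 * (φ ^ 2 + C ^ 2) = ε ^ 2 := by rw [hφC, mul_one]
    have h3 : k ^ 2 = φ ^ 2 + C ^ 2 - K ^ 2 := by linarith
    rw [h3]
    linarith
  have hkw : k * w = w' := by rw [hk]; field_simp
  calc ε ^ 2 * w ^ 2 * (1 - s ^ 2) = w ^ 2 * (ε ^ 2 * (1 - s ^ 2)) := by ring
    _ ≤ w ^ 2 * (k ^ 2 - s ^ 2) := by gcongr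
    _ = _ := by rw [← hkw]; ring

/-! ### Outer normals of triangles -/

/-- `ν` is the outer unit normal of the triangle `f` at its edge `a`, which lies on the line where
the inner product with `ν` is `c`. -/
structure IsOuterNormal (f a : Finset Plane) (ν : Plane) (c : ℝ) : Prop where
  unit : dot ν ν = 1
  on_edge : ∀ x ∈ convexHull ℝ (a : Set Plane), dot ν x = c
  lt_of_mem : ∀ z ∈ f, z ∉ a → dot ν z < c
  along : ∀ d, alongEdge a d = dot (perp ν) d • perp ν

lemma convex_dot_le (ν : Plane) (c : ℝ) : Convex ℝ {x | dot ν x ≤ c} :=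
  convex_halfSpace_le (isLinearMap_dot ν) c

lemma convex_three_mem {S : Set Plane} (hS : Convex ℝ S) {x y z : Plane} (hx : x ∈ S) (hy : y ∈ S)
    (hz : z ∈ S) {a b c : ℝ} (ha : 0 ≤ a) (hb : 0 ≤ b) (hc : 0 ≤ c) (h : a + b + c = 1) :
    a • x + b • y + c • z ∈ S := by
  have := hS.sum_mem (t := Finset.univ) (w := ![a, b, c]) (z := ![x, y, z])
    (by intro i _; fin_cases i <;> assumption) (by simp [Fin.sum_univ_three, h])
    (by intro i _; fin_cases i <;> assumption)
  simpa [Fin.sum_univ_three] using this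

namespace IsOuterNormal

variable {f a : Finset Plane} {ν : Plane} {c : ℝ}

lemma le_of_mem_hull (h : IsOuterNormal f a ν c) {x : Plane}
    (hx : x ∈ convexHull ℝ (f : Set Plane)) : dot ν x ≤ c := by
  refine convexHull_min (t := {x | dot ν x ≤ c}) (fun z hz => ?_) (convex_dot_le ν c) hx
  by_cases hza : z ∈ a
  · exact (h.on_edge z (subset_convexHull ℝ _ hza)).le
  · exact (h.lt_of_mem z hz hza).le

end IsOuterNormal

lemma lt_of_mem_interior {S : Set Plane} {ν : Plane} {c : ℝ} (hν : dot ν ν = 1)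
    (hS : ∀ x ∈ S, dot ν x ≤ c) {x : Plane} (hx : x ∈ interior S) : dot ν x < c := by
  obtain ⟨r, hr, hball⟩ := Metric.isOpen_iff.1 isOpen_interior x hx
  have hn : ‖ν‖ = 1 := by
    have := norm_sq_eq_dot ν
    rw [hν] at this
    exact (pow_eq_one_iff_of_nonneg (norm_nonneg ν) two_ne_zero).1 this
  have hmem : x + (r / 2) • ν ∈ Metric.ball x r := by
    rw [Metric.mem_ball, dist_eq_norm, add_sub_cancel_left, norm_smul, hn, mul_one,
      Real.norm_of_nonneg (by positivity)]
    linarith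
  have := hS _ (interior_subset (hball hmem))
  rw [dot_add_right, dot_smul_right, hν] at this
  linarith

namespace WeightedTriangulation

variable {T : WeightedTriangulation}

lemma exists_outerNormal {f a : Finset Plane} (hf : f ∈ T.triangles) (haf : a ⊆ f)
    (ha : a.card = 2) : ∃ ν c, IsOuterNormal f a ν c := by
  classical
  obtain ⟨p, q, hpq, rfl⟩ := Finset.card_eq_two.1 ha
  obtain ⟨z, hz⟩ : ∃ z, f \ {p, q} = {z} := by
    rw [← Finset.card_eq_one, Finset.card_sdiff_of_subset haf, ha, hf.2]
  have hzf : z ∈ f ∧ z ∉ ({p, q} : Finset Plane) := by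
    rw [← Finset.mem_sdiff, hz]; exact Finset.mem_singleton_self z
  have huniq : ∀ y ∈ f, y ∉ ({p, q} : Finset Plane) → y = z := by
    intro y h1 h2
    rw [← Finset.mem_singleton, ← hz, Finset.mem_sdiff]
    exact ⟨h1, h2⟩
  set τ := unitVec p q with hτ
  have hτ1 : dot τ τ = 1 := dot_unitVec_self hpq
  have hpqτ : q - p = dist p q • τ := dist_smul_unitVec hpq
  have hspan : ∀ d, alongEdge {p, q} d = dot τ d • τ := by
    intro d
    have hS : vectorSpan ℝ (({p, q} : Finset Plane) : Set Plane) = Submodule.span ℝ {τ} := by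
      rw [Finset.coe_pair, vectorSpan_pair_rev, vsub_eq_sub, hpqτ,
        Submodule.span_singleton_smul_eq (isUnit_iff_ne_zero.2 (dist_ne_zero.2 hpq))]
    have hn : ‖τ‖ = 1 := by
      have := norm_sq_eq_dot τ
      rw [hτ1] at this
      exact (pow_eq_one_iff_of_nonneg (norm_nonneg τ) two_ne_zero).1 this
    have key : ∀ (S : Submodule ℝ Plane) [S.HasOrthogonalProjection],
        S = Submodule.span ℝ {τ} → S.starProjection d = dot τ d • τ := by
      intro S _ h
      subst h
      rw [Submodule.starProjection_unit_singleton ℝ hn, inner_eq_dot]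
    exact key _ hS
  -- the normal up to sign
  obtain ⟨ν, hν1, hντ, hzν⟩ : ∃ ν, dot ν ν = 1 ∧ (perp ν = τ ∨ perp ν = (-1 : ℝ) • τ) ∧
      dot ν (z - p) ≤ 0 := by
    have hpp : perp (-perp τ) = τ := by apply plane_ext <;> simp [perp]
    have hpp' : perp (perp τ) = (-1 : ℝ) • τ := by apply plane_ext <;> simp [perp]
    rcases le_total (dot (perp τ) (z - p)) 0 with h | h
    · exact ⟨perp τ, by rw [dot_perp_perp, hτ1], Or.inr hpp', h⟩
    · refine ⟨-perp τ, ?_, Or.inl hpp, ?_⟩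
      · rw [← dot_perp_perp, hpp, hτ1]
      · have : dot (-perp τ) (z - p) = - dot (perp τ) (z - p) := by simp [dot]; ring
        linarith
  have hντ0 : dot ν (q - p) = 0 := by
    have h0 : dot ν (perp ν) = 0 := by simp [dot, perp]; ring
    rw [hpqτ, dot_smul_right]
    rcases hντ with h | h
    · rw [← h, h0, mul_zero]
    · rw [h, dot_smul_right] at h0
      have : dot ν τ = 0 := by linarith
      rw [this, mul_zero]
  -- A third vertex on the line of the edge would contradict affine independence of the vertices of
  -- the face.
  have hzne : dot ν (z - p) ≠ 0 := by
    intro h0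
    have hmem : z ∈ affineSpan ℝ ({p, q} : Set Plane) := by
      have h1 := eq_frame hν1 (z - p)
      rw [h0, zero_smul, add_zero] at h1
      obtain ⟨ρ, hρ⟩ : ∃ ρ : ℝ, z - p = ρ • (q - p) := by
        have hd : dist p q ≠ 0 := dist_ne_zero.2 hpq
        rcases hντ with h | h
        · refine ⟨dot (perp ν) (z - p) * (dist p q)⁻¹, ?_⟩
          rw [hpqτ, smul_smul, inv_mul_cancel_right₀ hd]
          exact h1.trans (by rw [h])
        · refine ⟨-dot (perp ν) (z - p) * (dist p q)⁻¹, ?_⟩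
          rw [hpqτ, smul_smul, inv_mul_cancel_right₀ hd, neg_smul, ← smul_neg, ← neg_one_smul ℝ τ,
            ← h]
          exact h1
      have : z = AffineMap.lineMap p q ρ := by
        rw [AffineMap.lineMap_apply, vsub_eq_sub, ← hρ]; simp
      rw [this]
      exact AffineMap.lineMap_mem_affineSpan_pair _ _ _
    have hind := T.indep hf.1
    have hp : p ∈ f := haf (by simp)
    have hq : q ∈ f := haf (by simp)
    have := (hind.mem_affineSpan_iff ⟨z, hzf.1⟩ {⟨p, hp⟩, ⟨q, hq⟩}).1
      (by rw [Set.image_pair]; exact hmem)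
    apply hzf.2
    simpa using this
  refine ⟨ν, dot ν p, hν1, ?_, ?_, ?_⟩
  · intro x hx
    rw [Finset.coe_pair, convexHull_pair] at hx
    obtain ⟨s, t, -, -, hst, rfl⟩ := hx
    rw [dot_sub_right] at hντ0
    rw [dot_add_right, dot_smul_right, dot_smul_right, show dot ν q = dot ν p by linarith,
      ← add_mul, hst, one_mul]
  · intro y hy hya
    rw [huniq y hy hya]
    have := lt_of_le_of_ne hzν hzne
    rw [dot_sub_right] at this
    linarith
  · intro d
    rw [hspan]
    rcases hντ with h | h
    · rw [h]
    · rw [h, dot_smul_left, smul_smul]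
      congr 1; ring

/-- Two triangles that share an edge lie on different sides of it. -/
lemma opposite_side {f g a : Finset Plane} (hf : f ∈ T.triangles) (hg : g ∈ T.triangles)
    (hfg : g ≠ f) (haf : a ⊆ f) (hag : a ⊆ g) (ha : a.card = 2) {ν : Plane} {c : ℝ}
    (h : IsOuterNormal f a ν c) : IsOuterNormal g a (-ν) (-c) := by
  classical
  obtain ⟨ν', c', h'⟩ := exists_outerNormal hg hag ha
  have hneg : ∀ x y : Plane, dot (-x) y = - dot x y := by intro x y; simp [dot]; ring
  have hperp : perp (-ν) = - perp ν := by apply plane_ext <;> simp [perp]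
  obtain ⟨p, q, hpq, rfl⟩ := Finset.card_eq_two.1 ha
  have hpa : p ∈ convexHull ℝ ((({p, q} : Finset Plane)) : Set Plane) :=
    subset_convexHull ℝ _ (by simp)
  have hqa : q ∈ convexHull ℝ ((({p, q} : Finset Plane)) : Set Plane) :=
    subset_convexHull ℝ _ (by simp)
  -- the two normals are parallel
  have hpar : ν' = ν ∨ ν' = -ν := by
    have e1 := h'.along (perp ν')
    rw [h.along, dot_perp_perp, h'.unit, one_smul] at e1
    set l := dot (perp ν) (perp ν') with hl
    have hνν : ν' = l • ν := by
      have e2 : ∀ i, (l • perp ν) i = perp ν' i := fun i => by rw [e1]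
      have e20 := e2 0
      have e21 := e2 1
      simp [perp] at e20 e21
      apply plane_ext <;> simp <;> linarith
    have hl2 : l ^ 2 = 1 := by
      have := h'.unit
      rw [hνν, dot_smul_left, dot_smul_right, h.unit] at this
      linarith
    rcases eq_or_eq_neg_of_sq_eq_sq l 1 (by rw [hl2, one_pow]) with h3 | h3
    · left; rw [hνν, h3, one_smul]
    · right; rw [hνν, h3, neg_one_smul]
  rcases hpar with rfl | rfl
  · exfalso
    have hcc : c' = c := by rw [← h.on_edge p hpa, ← h'.on_edge p hpa]
    subst hcc
    obtain ⟨z, hzf, hza⟩ : ∃ z ∈ f, z ∉ ({p, q} : Finset Plane) := by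
      by_contra! hcon
      have := Finset.card_le_card (show f ⊆ {p, q} from hcon)
      rw [ha, hf.2] at this; omega
    obtain ⟨b, hbg, hba⟩ : ∃ z ∈ g, z ∉ ({p, q} : Finset Plane) := by
      by_contra! hcon
      have := Finset.card_le_card (show g ⊆ {p, q} from hcon)
      rw [ha, hg.2] at this; omega
    have hz := h.lt_of_mem z hzf hza
    have hb := h'.lt_of_mem b hbg hba
    have hp := h.on_edge p hpa
    have hq := h.on_edge q hqa
    -- If both apexes lie on the same side, `b` has a positive coordinate γ in the direction of `z`.
    -- A point close to the midpoint of the edge, moved slightly towards `b`, then lies in both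
    -- triangles but not on the edge.
    obtain ⟨ρ, γ, hγ, hbz⟩ : ∃ ρ γ : ℝ, 0 < γ ∧ b = p + ρ • (q - p) + γ • (z - p) := by
      set γ := dot ν' (b - p) / dot ν' (z - p) with hγdef
      have hz0 : dot ν' (z - p) < 0 := by rw [dot_sub_right]; linarith
      have hb0 : dot ν' (b - p) < 0 := by rw [dot_sub_right]; linarith
      have hy : dot ν' (b - p - γ • (z - p)) = 0 := by
        rw [dot_sub_right, dot_smul_right, hγdef, div_mul_cancel₀ _ hz0.ne, sub_self]
      have hx : dot ν' (q - p) = 0 := by rw [dot_sub_right]; linarith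
      have e1 := eq_frame h.unit (b - p - γ • (z - p))
      have e2 := eq_frame h.unit (q - p)
      rw [hy, zero_smul, add_zero] at e1
      rw [hx, zero_smul, add_zero] at e2
      have hne : dot (perp ν') (q - p) ≠ 0 := by
        intro h0
        rw [h0, zero_smul, sub_eq_zero] at e2
        exact hpq e2.symm
      refine ⟨dot (perp ν') (b - p - γ • (z - p)) / dot (perp ν') (q - p), γ,
        div_pos_of_neg_of_neg hb0 hz0, ?_⟩
      rw [e2, dot_smul_right, dot_perp_perp, h.unit, mul_one, smul_smul, div_mul_cancel₀ _ hne,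
        ← e1]
      abel
    -- Chosen so that t|ρ| and t|1 - ρ - γ| are at most (1 - t) / 2, which makes the barycentric
    -- coordinates of `x` in `f` nonnegative.
    set t : ℝ := 1 / (1 + 2 * |ρ| + 2 * |1 - ρ - γ|) with ht
    have hD : 0 < 1 + 2 * |ρ| + 2 * |1 - ρ - γ| := by positivity
    have ht0 : 0 < t := by positivity
    have htD : t * (1 + 2 * |ρ| + 2 * |1 - ρ - γ|) = 1 := by rw [ht]; field_simp
    have ht1 : t ≤ 1 := by
      have h1 : 0 ≤ t * (2 * |ρ| + 2 * |1 - ρ - γ|) := by positivity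
      linarith
    set x : Plane := ((1 - t) / 2) • p + ((1 - t) / 2) • q + t • b with hx
    have hxg : x ∈ convexHull ℝ (g : Set Plane) := by
      have hc := convex_convexHull ℝ (g : Set Plane)
      have m1 : p ∈ convexHull ℝ (g : Set Plane) := subset_convexHull ℝ _ (hag (by simp))
      have m2 : q ∈ convexHull ℝ (g : Set Plane) := subset_convexHull ℝ _ (hag (by simp))
      have m3 : b ∈ convexHull ℝ (g : Set Plane) := subset_convexHull ℝ _ hbg
      exact convex_three_mem hc m1 m2 m3 (by linarith) (by linarith) ht0.le (by ring)
    have hxf : x ∈ convexHull ℝ (f : Set Plane) := by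
      have hc := convex_convexHull ℝ (f : Set Plane)
      have m1 : p ∈ convexHull ℝ (f : Set Plane) := subset_convexHull ℝ _ (haf (by simp))
      have m2 : q ∈ convexHull ℝ (f : Set Plane) := subset_convexHull ℝ _ (haf (by simp))
      have m3 : z ∈ convexHull ℝ (f : Set Plane) := subset_convexHull ℝ _ hzf
      have hxe : x = ((1 - t) / 2 + t * (1 - ρ - γ)) • p + ((1 - t) / 2 + t * ρ) • q
          + (t * γ) • z := by
        rw [hx, hbz]; module
      rw [hxe]
      have b1 := mul_le_mul_of_nonneg_left (neg_abs_le ρ) ht0.le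
      have b2 := mul_le_mul_of_nonneg_left (neg_abs_le (1 - ρ - γ)) ht0.le
      have b3 := mul_nonneg ht0.le (abs_nonneg ρ)
      have b4 := mul_nonneg ht0.le (abs_nonneg (1 - ρ - γ))
      exact convex_three_mem hc m1 m2 m3 (by linarith) (by linarith) (by positivity) (by ring)
    -- The faces of a simplicial complex meet only in their common face, here the edge; but `x` is
    -- strictly inside.
    have hxa := T.inter_subset_convexHull hf.1 hg.1 ⟨hxf, hxg⟩
    have hsub : ((f : Set Plane) ∩ g) ⊆ (({p, q} : Finset Plane) : Set Plane) := by
      have hcard : (f ∩ g).card ≤ 2 := by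
        by_contra! hlt
        have h1 : f ∩ g = f := Finset.eq_of_subset_of_card_le Finset.inter_subset_left
          (by rw [hf.2]; omega)
        have h2 : f ∩ g = g := Finset.eq_of_subset_of_card_le Finset.inter_subset_right
          (by rw [hg.2]; omega)
        exact hfg (h2.symm.trans h1)
      have := Finset.eq_of_subset_of_card_le (Finset.subset_inter haf hag) (by rw [ha]; exact hcard)
      rw [this, Finset.coe_inter]
    have := h.on_edge x (convexHull_mono hsub hxa)
    rw [hx, dot_add_right, dot_add_right, dot_smul_right, dot_smul_right, dot_smul_right, hp, hq]
      at this
    have hlt := mul_lt_mul_of_pos_left hb ht0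
    linarith
  · refine ⟨h'.unit, fun x hx => by rw [hneg, h.on_edge x hx], ?_, ?_⟩
    · have hcc : c' = -c := by rw [← h.on_edge p hpa, ← h'.on_edge p hpa, hneg]
      rw [← hcc]; exact h'.lt_of_mem
    · exact h'.along

end WeightedTriangulation

namespace WeightedTriangulation

variable {T : WeightedTriangulation}

/-- Distinct triangles have at most two common vertices. Hence rays with the same face sequence
cross the same edges, and the face sequence alone suffices up to the last strike. -/
lemma edge_eq_of_subset {f g a b : Finset Plane} (hf : f ∈ T.triangles) (hg : g ∈ T.triangles)
    (hfg : g ≠ f) (ha : a.card = 2) (hb : b.card = 2) (haf : a ⊆ f) (hag : a ⊆ g) (hbf : b ⊆ f)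
    (hbg : b ⊆ g) : a = b := by
  classical
  have hcard : (f ∩ g).card ≤ 2 := by
    by_contra! hlt
    have h1 : f ∩ g = f := Finset.eq_of_subset_of_card_le Finset.inter_subset_left
      (by rw [hf.2]; omega)
    have h2 : f ∩ g = g := Finset.eq_of_subset_of_card_le Finset.inter_subset_right
      (by rw [hg.2]; omega)
    exact hfg (h2.symm.trans h1)
  have h1 := Finset.eq_of_subset_of_card_le (Finset.subset_inter haf hag) (by rw [ha]; exact hcard)
  have h2 := Finset.eq_of_subset_of_card_le (Finset.subset_inter hbf hbg) (by rw [hb]; exact hcard)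
  rw [h1, h2]

end WeightedTriangulation

/-! ### Strikes and refraction in normal coordinates -/

section Strikes

variable {T : WeightedTriangulation} {o ν : Plane} {s s' : Strike} {c ε : ℝ}

/-- Tested at the midpoint, this shows that a segment with one end on a supporting line of the
triangle has its other end strictly on the inner side. -/
lemma midpoint_dot_lt (hν : dot ν ν = 1) {f : Finset Plane} {x y : Plane}
    (hf : ∀ z ∈ convexHull ℝ (f : Set Plane), dot ν z ≤ c)
    (hxy : openSegment ℝ x y ⊆ interior (convexHull ℝ (f : Set Plane))) :
    dot ν x + dot ν y < 2 * c := by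
  have hm : (1 / 2 : ℝ) • x + (1 / 2 : ℝ) • y ∈ openSegment ℝ x y :=
    ⟨1 / 2, 1 / 2, by norm_num, by norm_num, by norm_num, rfl⟩
  have := lt_of_mem_interior hν hf (hxy hm)
  rw [dot_add_right, dot_smul_right, dot_smul_right] at this
  linarith

lemma Strikes.ne (h : Strikes T o s) : o ≠ s.pt := by
  obtain ⟨hf, he, hef, -, hpt, hseg⟩ := h
  obtain ⟨ν, c, hn⟩ := WeightedTriangulation.exists_outerNormal hf hef he.2
  rintro rfl
  have := midpoint_dot_lt hn.unit (fun z => hn.le_of_mem_hull) hseg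
  rw [hn.on_edge _ hpt] at this
  linarith

lemma Strikes.dot_unitVec_self (h : Strikes T o s) :
    dot (unitVec o s.pt) (unitVec o s.pt) = 1 := _root_.dot_unitVec_self h.ne

lemma Strikes.sub_eq (h : Strikes T o s) : s.pt - o = dist o s.pt • unitVec o s.pt :=
  dist_smul_unitVec h.ne

lemma Strikes.dot_sub (h : Strikes T o s) (x : Plane) :
    dot x (s.pt - o) = dist o s.pt * dot x (unitVec o s.pt) := by
  conv_lhs => rw [h.sub_eq]
  rw [dot_smul_right]

lemma Strikes.dist_pos (h : Strikes T o s) : 0 < dist o s.pt := _root_.dist_pos.2 h.ne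

/-- A ray strikes an edge from the inner side. -/
lemma Strikes.dot_normal_pos (h : Strikes T o s) (hn : IsOuterNormal s.face s.edge ν c) :
    0 < dot ν (unitVec o s.pt) := by
  have h1 := midpoint_dot_lt hn.unit (fun z => hn.le_of_mem_hull) h.2.2.2.2.2
  have h2 := hn.on_edge _ h.2.2.2.2.1
  have h3 := h.dot_sub ν
  rw [dot_sub_right] at h3
  exact pos_of_mul_pos_right (by rw [← h3]; linarith) h.dist_pos.le

/-- A ray that starts on an edge of a triangle leaves it to the inner side. -/
lemma Strikes.dot_normal_neg (h : Strikes T o s) {a : Finset Plane}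
    (hn : IsOuterNormal s.face a ν c) (ho : o ∈ convexHull ℝ (a : Set Plane)) :
    dot ν (unitVec o s.pt) < 0 := by
  have h1 := midpoint_dot_lt hn.unit (fun z => hn.le_of_mem_hull) h.2.2.2.2.2
  have h2 := hn.on_edge _ ho
  have h3 := h.dot_sub ν
  rw [dot_sub_right] at h3
  have : dist o s.pt * dot ν (unitVec o s.pt) < 0 := by rw [← h3]; linarith
  exact neg_of_mul_neg_right this h.dist_pos.le

lemma Refracts.dot_normal_pos (hr : Refracts T o s s') (h : Strikes T o s)
    (h' : Strikes T s.pt s') (hn : IsOuterNormal s.face s.edge ν c) :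
    0 < dot ν (unitVec s.pt s'.pt) := by
  have := h'.dot_normal_neg
    (WeightedTriangulation.opposite_side h.1 h'.1 hr.2.1 h.2.2.1 hr.2.2.1 h.2.1.2 hn) h.2.2.2.2.1
  have h2 : dot (-ν) (unitVec s.pt s'.pt) = - dot ν (unitVec s.pt s'.pt) := by simp [dot]; ring
  linarith

lemma Refracts.snell (hr : Refracts T o s s') (hn : IsOuterNormal s.face s.edge ν c) :
    (T.weight s.face : ℝ) * dot (perp ν) (unitVec o s.pt) =
      T.weight s'.face * dot (perp ν) (unitVec s.pt s'.pt) := by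
  have h := hr.2.2.2.2
  rw [hn.along, hn.along, smul_smul, smul_smul] at h
  have := congrArg (dot (perp ν)) h
  rwa [dot_smul_right, dot_smul_right, dot_perp_perp, hn.unit, mul_one, mul_one] at this

lemma incidenceAngle_eq (hn : IsOuterNormal s.face s.edge ν c) :
    incidenceAngle s.edge o s.pt = Real.arcsin |dot (perp ν) (unitVec o s.pt)| := by
  rw [incidenceAngle, hn.along, norm_smul]
  have : ‖perp ν‖ = 1 := by
    have := norm_sq_eq_dot (perp ν)
    rw [dot_perp_perp, hn.unit] at this
    exact (pow_eq_one_iff_of_nonneg (norm_nonneg _) two_ne_zero).1 this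
  rw [this, mul_one, Real.norm_eq_abs]

lemma weight_pos_of_mem {f : Finset Plane} (hf : f ∈ T.triangles) : (1 : ℝ) ≤ T.weight f := by
  exact_mod_cast T.weight_pos f hf.1 hf.2

/-- Where a ray keeps off the critical angle, its angle of refraction stays off the right angle. -/
lemma cos_sq_refract_of_avoids (h : Strikes T o s) (h' : Strikes T s.pt s')
    (hn : IsOuterNormal s.face s.edge ν c) (hε : 0 < ε)
    (hW : ∀ f ∈ T.triangles, 4 * ε * T.weight f ≤ 1)
    (hav : T.weight s'.face < T.weight s.face →
      incidenceAngle s.edge o s.pt ≤ T.criticalAngle s.face s'.face - ε) :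
    ε ^ 2 * (T.weight s.face : ℝ) ^ 2 * (1 - dot (perp ν) (unitVec o s.pt) ^ 2) ≤
      (T.weight s'.face : ℝ) ^ 2 -
        (T.weight s.face : ℝ) ^ 2 * dot (perp ν) (unitVec o s.pt) ^ 2 := by
  have hsc := sin_sq_add_cos_sq hn.unit h.dot_unitVec_self
  have hs1 : dot (perp ν) (unitVec o s.pt) ^ 2 ≤ 1 := by nlinarith
  have w1 := weight_pos_of_mem h.1
  have w1' := weight_pos_of_mem h'.1
  rcases lt_or_ge (T.weight s'.face) (T.weight s.face) with hw | hw
  · have h1 := hav hw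
    rw [incidenceAngle_eq hn] at h1
    have := le_cos_sq_refract_of_le_critical (abs_nonneg _)
      ((sq_le_one_iff_abs_le_one _).1 hs1) w1' (by exact_mod_cast hw) le_rfl hε (hW _ h.1) h1
    rwa [sq_abs] at this
  · have hw' : (T.weight s.face : ℝ) ≤ T.weight s'.face := by exact_mod_cast hw
    have hε1 : ε ^ 2 ≤ 1 := by
      apply pow_le_one₀ hε.le
      have := hW _ h.1
      nlinarith
    have e1 : ε ^ 2 * ((T.weight s.face : ℝ) ^ 2 * (1 - dot (perp ν) (unitVec o s.pt) ^ 2)) ≤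
        1 * ((T.weight s.face : ℝ) ^ 2 * (1 - dot (perp ν) (unitVec o s.pt) ^ 2)) :=
      mul_le_mul_of_nonneg_right hε1 (mul_nonneg (sq_nonneg _) (by linarith))
    have e2 : (T.weight s.face : ℝ) ^ 2 ≤ (T.weight s'.face : ℝ) ^ 2 := by gcongr
    linarith

/-- By Snell's law the right side of `hG` is the square of w' times the refracted cosine; both
cosines are positive, so square roots can be taken. -/
lemma Refracts.cos_le (hr : Refracts T o s s') (h : Strikes T o s) (h' : Strikes T s.pt s')
    (hn : IsOuterNormal s.face s.edge ν c)
    (hG : ε ^ 2 * (T.weight s.face : ℝ) ^ 2 * (1 - dot (perp ν) (unitVec o s.pt) ^ 2) ≤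
      (T.weight s'.face : ℝ) ^ 2 -
        (T.weight s.face : ℝ) ^ 2 * dot (perp ν) (unitVec o s.pt) ^ 2) :
    ε * T.weight s.face * dot ν (unitVec o s.pt) ≤
      T.weight s'.face * dot ν (unitVec s.pt s'.pt) := by
  have hsn := hr.snell hn
  have hp := hr.dot_normal_pos h h' hn
  have h1 := sin_sq_add_cos_sq hn.unit h.dot_unitVec_self
  have h2 := sin_sq_add_cos_sq hn.unit h'.dot_unitVec_self
  apply le_of_sq_le_sq _ (by positivity)
  calc _ = ε ^ 2 * (T.weight s.face : ℝ) ^ 2 * dot ν (unitVec o s.pt) ^ 2 := by ring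
    _ = ε ^ 2 * (T.weight s.face : ℝ) ^ 2 * (1 - dot (perp ν) (unitVec o s.pt) ^ 2) := by
      rw [← h1]; ring
    _ ≤ _ := hG
    _ = (T.weight s'.face : ℝ) ^ 2 -
        (T.weight s.face * dot (perp ν) (unitVec o s.pt)) ^ 2 := by ring
    _ = (T.weight s'.face * dot ν (unitVec s.pt s'.pt)) ^ 2 := by
      rw [hsn]; linear_combination (-(T.weight s'.face : ℝ) ^ 2) * h2

end Strikes

/-! ### Order and angle of two rays -/

/-- The ray from `o'` in direction `d'` is to the left of the one from `o` in direction `d`, and they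
do not converge. -/
structure LeftOf (o d o' d' : Plane) : Prop where
  dir : 0 ≤ cross d d'
  left : 0 ≤ cross d (o' - o)
  right : 0 ≤ cross d' (o' - o)

/-- The tangent of half the angle between two unit vectors is at most `M`. -/
def HalfAngleLE (M : ℝ) (d d' : Plane) : Prop := 1 - dot d d' ≤ M ^ 2 * (1 + dot d d')

lemma HalfAngleLE.symm {M : ℝ} {d d' : Plane} (h : HalfAngleLE M d d') : HalfAngleLE M d' d := by
  rwa [HalfAngleLE, dot_comm d' d]

lemma HalfAngleLE.one_sub_le {M : ℝ} {d d' : Plane} (h : HalfAngleLE M d d')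
    (hd : dot d d = 1) (hd' : dot d' d' = 1) : 1 - 2 * M ^ 2 ≤ dot d d' := by
  have h1 := dot_le_one hd hd'
  have := mul_le_mul_of_nonneg_left h1 (sq_nonneg M)
  unfold HalfAngleLE at h
  linarith

lemma cross_add_smul (d x d' : Plane) (l : ℝ) : cross d (x + l • d') = cross d x + l * cross d d' := by
  simp [cross]; ring

/-- Since the directions do not converge, advancing along either ray adds a nonnegative multiple of
`cross d d'` to the offsets. -/
lemma LeftOf.travel {T : WeightedTriangulation} {o o' : Plane} {s s' : Strike}
    (h : Strikes T o s) (h' : Strikes T o' s')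
    (H : LeftOf o (unitVec o s.pt) o' (unitVec o' s'.pt)) :
    LeftOf s.pt (unitVec o s.pt) s'.pt (unitVec o' s'.pt) := by
  have e : s'.pt - s.pt = (o' - o) + dist o' s'.pt • unitVec o' s'.pt
      + (-dist o s.pt) • unitVec o s.pt := by
    rw [neg_smul, ← h.sub_eq, ← h'.sub_eq]; abel
  have hself : ∀ x, cross x x = 0 := fun x => by simp [cross]; ring
  have hanti : ∀ x y, cross x y = - cross y x := fun x y => by simp [cross]; ring
  refine ⟨H.dir, ?_, ?_⟩
  · rw [e, cross_add_smul, cross_add_smul, hself, mul_zero, add_zero]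
    exact add_nonneg H.left (mul_nonneg h'.dist_pos.le H.dir)
  · rw [e, cross_add_smul, cross_add_smul, hself, mul_zero, add_zero,
      hanti (unitVec o' s'.pt) (unitVec o s.pt), neg_mul_neg]
    exact add_nonneg H.right (mul_nonneg h.dist_pos.le H.dir)

section PairStep

variable {T : WeightedTriangulation} {o o₁ ν : Plane} {s s' s₁ s₁' : Strike} {c ε M : ℝ}

/-- After travelling, both rays are on one edge. The order of directions survives by
`cross_refract_nonneg`, and the order of positions by `cross_transfer`, as the offset now lies along
the edge. -/
lemma LeftOf.refract (h : Strikes T o s) (h' : Strikes T s.pt s') (hr : Refracts T o s s')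
    (h₁ : Strikes T o₁ s₁) (h₁' : Strikes T s₁.pt s₁') (hr₁ : Refracts T o₁ s₁ s₁')
    (hf : s₁.face = s.face) (hf' : s₁'.face = s'.face) (he : s₁.edge = s.edge)
    (hn : IsOuterNormal s.face s.edge ν c)
    (H : LeftOf o (unitVec o s.pt) o₁ (unitVec o₁ s₁.pt)) :
    LeftOf s.pt (unitVec s.pt s'.pt) s₁.pt (unitVec s₁.pt s₁'.pt) := by
  have H' := H.travel h h₁
  have hn₁ : IsOuterNormal s₁.face s₁.edge ν c := by rw [hf, he]; exact hn
  have hsn₁ := hr₁.snell hn₁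
  rw [hf, hf'] at hsn₁
  have hx : dot ν (s₁.pt - s.pt) = 0 := by
    rw [dot_sub_right, hn₁.on_edge _ h₁.2.2.2.2.1, hn.on_edge _ h.2.2.2.2.1, sub_self]
  have w1 := weight_pos_of_mem h.1
  have w1' := weight_pos_of_mem h'.1
  refine ⟨?_, ?_, ?_⟩
  · exact cross_refract_nonneg hn.unit h.dot_unitVec_self h₁.dot_unitVec_self h'.dot_unitVec_self
      h₁'.dot_unitVec_self (h.dot_normal_pos hn) (h₁.dot_normal_pos hn₁)
      (hr.dot_normal_pos h h' hn) (hr₁.dot_normal_pos h₁ h₁' hn₁) (by linarith) (by linarith)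
      (hr.snell hn) hsn₁ H'.dir
  · exact cross_transfer hn.unit hx (h.dot_normal_pos hn) (hr.dot_normal_pos h h' hn) H'.left
  · exact cross_transfer hn.unit hx (h₁.dot_normal_pos hn₁) (hr₁.dot_normal_pos h₁ h₁' hn₁) H'.right

lemma HalfAngleLE.refract (h : Strikes T o s) (h' : Strikes T s.pt s') (hr : Refracts T o s s')
    (h₁ : Strikes T o₁ s₁) (h₁' : Strikes T s₁.pt s₁') (hr₁ : Refracts T o₁ s₁ s₁')
    (hf : s₁.face = s.face) (hf' : s₁'.face = s'.face) (he : s₁.edge = s.edge)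
    (hn : IsOuterNormal s.face s.edge ν c) (hε : 0 < ε)
    (hG : ε ^ 2 * (T.weight s.face : ℝ) ^ 2 * (1 - dot (perp ν) (unitVec o s.pt) ^ 2) ≤
      (T.weight s'.face : ℝ) ^ 2 -
        (T.weight s.face : ℝ) ^ 2 * dot (perp ν) (unitVec o s.pt) ^ 2)
    (hG₁ : ε ^ 2 * (T.weight s.face : ℝ) ^ 2 * (1 - dot (perp ν) (unitVec o₁ s₁.pt) ^ 2) ≤
      (T.weight s'.face : ℝ) ^ 2 -
        (T.weight s.face : ℝ) ^ 2 * dot (perp ν) (unitVec o₁ s₁.pt) ^ 2)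
    (H : HalfAngleLE M (unitVec o s.pt) (unitVec o₁ s₁.pt)) :
    HalfAngleLE (M / ε) (unitVec s.pt s'.pt) (unitVec s₁.pt s₁'.pt) := by
  have hn₁ : IsOuterNormal s₁.face s₁.edge ν c := by rw [hf, he]; exact hn
  have hsn₁ := hr₁.snell hn₁
  have w1 := weight_pos_of_mem h.1
  have w1' := weight_pos_of_mem h'.1
  have hc := hr.cos_le h h' hn hG
  rw [← hf, ← hf'] at hG₁
  have hc₁ := hr₁.cos_le h₁ h₁' hn₁ hG₁
  rw [hf, hf'] at hsn₁ hc₁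
  exact half_angle_refract hn.unit h.dot_unitVec_self h₁.dot_unitVec_self h'.dot_unitVec_self
      h₁'.dot_unitVec_self (h.dot_normal_pos hn) (h₁.dot_normal_pos hn₁)
      (hr.dot_normal_pos h h' hn) (hr₁.dot_normal_pos h₁ h₁' hn₁) (by linarith) (by linarith) hε
      (hr.snell hn) hsn₁ hc hc₁ H

/-- One step of the comparison of the weighted lengths of two paths through the same faces. -/
lemma cost_step (h : Strikes T o s) (hr : Refracts T o s s')
    (h₁ : Strikes T o₁ s₁) (hf : s₁.face = s.face) (he : s₁.edge = s.edge)
    (hn : IsOuterNormal s.face s.edge ν c) {q : ℝ}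
    (H : 1 - q ≤ dot (unitVec o s.pt) (unitVec o₁ s₁.pt)) :
    (1 - q) * (T.weight s.face * dist o₁ s₁.pt) ≤ T.weight s.face * dist o s.pt +
      T.weight s'.face * dot (unitVec s.pt s'.pt) (s₁.pt - s.pt) -
      T.weight s.face * dot (unitVec o s.pt) (o₁ - o) := by
  have hn₁ : IsOuterNormal s₁.face s₁.edge ν c := by rw [hf, he]; exact hn
  have hx : dot ν (s₁.pt - s.pt) = 0 := by
    rw [dot_sub_right, hn₁.on_edge _ h₁.2.2.2.2.1, hn.on_edge _ h.2.2.2.2.1, sub_self]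
  -- The calibration step: the offset lies along the edge, where Snell's law makes w d and w' d'
  -- agree. The boundary term of this face is thus that of the next one.
  have hsn : (T.weight s'.face : ℝ) * dot (unitVec s.pt s'.pt) (s₁.pt - s.pt) =
      T.weight s.face * dot (unitVec o s.pt) (s₁.pt - s.pt) := by
    rw [dot_eq_frame hn.unit, dot_eq_frame hn.unit (unitVec o s.pt), hx]
    linear_combination (-dot (perp ν) (s₁.pt - s.pt)) * hr.snell hn
  rw [hsn]
  have e1 := h₁.dot_sub (unitVec o s.pt)
  have e2 := h.dot_sub (unitVec o s.pt)
  rw [h.dot_unitVec_self, mul_one] at e2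
  have e3 := mul_le_mul_of_nonneg_left H h₁.dist_pos.le
  have w1 := weight_pos_of_mem h.1
  simp only [dot_sub_right] at *
  have e4 : (1 - q) * dist o₁ s₁.pt ≤ dist o s.pt
      + (dot (unitVec o s.pt) s₁.pt - dot (unitVec o s.pt) s.pt)
      - (dot (unitVec o s.pt) o₁ - dot (unitVec o s.pt) o) := by linarith
  have e5 := mul_le_mul_of_nonneg_left e4 (zero_le_one.trans w1)
  linarith

/-- The comparison of the lengths of the last segments. -/
lemma cost_last (h : Strikes T o s) (h₁ : Strikes T o₁ s₁) {q : ℝ}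
    (H : 1 - q ≤ dot (unitVec o s.pt) (unitVec o₁ s₁.pt)) :
    (1 - q) * (T.weight s.face * dist o₁ s₁.pt) ≤ T.weight s.face * dist o s.pt +
      T.weight s.face * dot (unitVec o s.pt) (s₁.pt - s.pt) -
      T.weight s.face * dot (unitVec o s.pt) (o₁ - o) := by
  have e1 := h₁.dot_sub (unitVec o s.pt)
  have e2 := h.dot_sub (unitVec o s.pt)
  rw [h.dot_unitVec_self, mul_one] at e2
  have e3 := mul_le_mul_of_nonneg_left H h₁.dist_pos.le
  have w1 := weight_pos_of_mem h.1
  simp only [dot_sub_right] at *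
  have e4 : (1 - q) * dist o₁ s₁.pt ≤ dist o s.pt
      + (dot (unitVec o s.pt) s₁.pt - dot (unitVec o s.pt) s.pt)
      - (dot (unitVec o s.pt) o₁ - dot (unitVec o s.pt) o) := by linarith
  have e5 := mul_le_mul_of_nonneg_left e4 (zero_le_one.trans w1)
  linarith

end PairStep

/-! ### Comparison along whole paths -/

/-- The last segments of three paths through the same faces, from `p₁`, `p`, `p₂` to the strikes
`t₁`, `t`, `t₂`: they begin on one edge of the last face and are in order. -/
structure LastSegments (T : WeightedTriangulation) (p p₁ p₂ : Plane) (t t₁ t₂ : Strike) :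
    Prop where
  strikes : Strikes T p t
  strikes₁ : Strikes T p₁ t₁
  strikes₂ : Strikes T p₂ t₂
  face₁ : t₁.face = t.face
  face₂ : t₂.face = t.face
  start : ∃ a ∈ T.edges, a ⊆ t.face ∧ p ∈ convexHull ℝ (a : Set Plane) ∧
    p₁ ∈ convexHull ℝ (a : Set Plane) ∧ p₂ ∈ convexHull ℝ (a : Set Plane)
  left₁ : LeftOf p₁ (unitVec p₁ t₁.pt) p (unitVec p t.pt)
  left₂ : LeftOf p (unitVec p t.pt) p₂ (unitVec p₂ t₂.pt)

lemma IsRefractedPath.head {T : WeightedTriangulation} {o : Plane} {s : Strike} {L : List Strike}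
    (h : IsRefractedPath T o (s :: L)) : Strikes T o s := by
  cases L with
  | nil => exact h
  | cons => exact h.1

lemma pathCost_cons (T : WeightedTriangulation) (o : Plane) (s : Strike) (L : List Strike) :
    pathCost T o (s :: L) = T.weight s.face * dist o s.pt + pathCost T s.pt L := rfl

/-- Of three rays in order that traverse the same faces, the outer ones close together and away from
critical angles, the outer ones are not much longer than the inner one, up to a term that depends on
the end points. -/
lemma exists_lastSegments {T : WeightedTriangulation} {ε M₀ : ℝ} (hε : 0 < ε) (hε1 : ε ≤ 1)
    (hW : ∀ f ∈ T.triangles, 4 * ε * T.weight f ≤ 1) (L : List Strike) :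
    ∀ (L₁ L₂ : List Strike) (s s₁ s₂ : Strike) (o o₁ o₂ : Plane) (M : ℝ),
    IsRefractedPath T o (s :: L) → IsRefractedPath T o₁ (s₁ :: L₁) →
    IsRefractedPath T o₂ (s₂ :: L₂) →
    AvoidsCritical T ε o₁ (s₁ :: L₁) → AvoidsCritical T ε o₂ (s₂ :: L₂) →
    s₁.face = s.face → s₂.face = s.face →
    L₁.map Strike.face = L.map Strike.face → L₂.map Strike.face = L.map Strike.face →
    (∃ a ∈ T.edges, a ⊆ s.face ∧ o ∈ convexHull ℝ (a : Set Plane) ∧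
      o₁ ∈ convexHull ℝ (a : Set Plane) ∧ o₂ ∈ convexHull ℝ (a : Set Plane)) →
    LeftOf o₁ (unitVec o₁ s₁.pt) o (unitVec o s.pt) →
    LeftOf o (unitVec o s.pt) o₂ (unitVec o₂ s₂.pt) →
    HalfAngleLE M (unitVec o s.pt) (unitVec o₁ s₁.pt) →
    HalfAngleLE M (unitVec o s.pt) (unitVec o₂ s₂.pt) →
    0 ≤ M → M ≤ M₀ * ε ^ L.length →
    ∃ p p₁ p₂ t t₁ t₂, (s :: L).getLast? = some t ∧ (s₁ :: L₁).getLast? = some t₁ ∧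
      (s₂ :: L₂).getLast? = some t₂ ∧ LastSegments T p p₁ p₂ t t₁ t₂ ∧
      (1 - 2 * M₀ ^ 2) * pathCost T o₁ (s₁ :: L₁) ≤ pathCost T o (s :: L) +
        T.weight t.face * dot (unitVec p t.pt) (t₁.pt - t.pt) -
        T.weight s.face * dot (unitVec o s.pt) (o₁ - o) ∧
      (1 - 2 * M₀ ^ 2) * pathCost T o₂ (s₂ :: L₂) ≤ pathCost T o (s :: L) +
        T.weight t.face * dot (unitVec p t.pt) (t₂.pt - t.pt) -
        T.weight s.face * dot (unitVec o s.pt) (o₂ - o) := by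
  -- Any half-angle tangent within the budget is at most `k`, so the cosine is at least 1 - 2k².
  have hdot : ∀ {M k : ℝ} {n : ℕ} {o o' : Plane} {s s' : Strike}, Strikes T o s →
      Strikes T o' s' → HalfAngleLE M (unitVec o s.pt) (unitVec o' s'.pt) → 0 ≤ M →
      M ≤ k * ε ^ n → 1 - 2 * k ^ 2 ≤ dot (unitVec o s.pt) (unitVec o' s'.pt) := by
    intro M k n o o' s s' h h' H hM hMk
    have h1 := H.one_sub_le h.dot_unitVec_self h'.dot_unitVec_self
    have h2 : 0 < ε ^ n := by positivity
    have h3 : ε ^ n ≤ 1 := pow_le_one₀ hε.le hε1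
    have hk : 0 ≤ k := nonneg_of_mul_nonneg_left (hM.trans hMk) h2
    have h4 : M ≤ k := hMk.trans (mul_le_of_le_one_right hk h3)
    have h5 : M ^ 2 ≤ k ^ 2 := by gcongr
    linarith
  induction L with
  | nil =>
    intro L₁ L₂ s s₁ s₂ o o₁ o₂ M hp hp₁ hp₂ _ _ hf₁ hf₂ hL₁ hL₂ hstart hl₁ hl₂ hM₁ hM₂ hM hMM
    obtain rfl : L₁ = [] := by simpa using hL₁
    obtain rfl : L₂ = [] := by simpa using hL₂
    simp only [IsRefractedPath] at hp hp₁ hp₂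
    refine ⟨o, o₁, o₂, s, s₁, s₂, rfl, rfl, rfl,
      ⟨hp, hp₁, hp₂, hf₁, hf₂, hstart, hl₁, hl₂⟩, ?_, ?_⟩
    · simp only [pathCost, add_zero]
      rw [hf₁]
      exact cost_last hp hp₁ (hdot hp hp₁ hM₁ hM hMM)
    · simp only [pathCost, add_zero]
      rw [hf₂]
      exact cost_last hp hp₂ (hdot hp hp₂ hM₂ hM hMM)
  | cons s' L ih =>
    intro L₁ L₂ s s₁ s₂ o o₁ o₂ M hp hp₁ hp₂ ha₁ ha₂ hf₁ hf₂ hL₁ hL₂ hstart hl₁ hl₂ hM₁ hM₂ hM hMM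
    obtain ⟨s₁', L₁, rfl⟩ : ∃ x l, L₁ = x :: l := by
      cases L₁ with
      | nil => simp at hL₁
      | cons x l => exact ⟨x, l, rfl⟩
    obtain ⟨s₂', L₂, rfl⟩ : ∃ x l, L₂ = x :: l := by
      cases L₂ with
      | nil => simp at hL₂
      | cons x l => exact ⟨x, l, rfl⟩
    simp only [List.map_cons, List.cons.injEq] at hL₁ hL₂
    obtain ⟨hf₁', hL₁⟩ := hL₁
    obtain ⟨hf₂', hL₂⟩ := hL₂
    obtain ⟨h, hr, hp⟩ := hp
    obtain ⟨h₁, hr₁, hp₁⟩ := hp₁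
    obtain ⟨h₂, hr₂, hp₂⟩ := hp₂
    obtain ⟨hav₁, ha₁⟩ := ha₁
    obtain ⟨hav₂, ha₂⟩ := ha₂
    have h' := hp.head
    have h₁' := hp₁.head
    have h₂' := hp₂.head
    have he₁ : s₁.edge = s.edge :=
      WeightedTriangulation.edge_eq_of_subset h.1 h'.1 hr.2.1 h₁.2.1.2 h.2.1.2 (hf₁ ▸ h₁.2.2.1)
        (hf₁' ▸ hr₁.2.2.1) h.2.2.1 hr.2.2.1
    have he₂ : s₂.edge = s.edge :=
      WeightedTriangulation.edge_eq_of_subset h.1 h'.1 hr.2.1 h₂.2.1.2 h.2.1.2 (hf₂ ▸ h₂.2.2.1)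
        (hf₂' ▸ hr₂.2.2.1) h.2.2.1 hr.2.2.1
    obtain ⟨ν, c, hn⟩ := WeightedTriangulation.exists_outerNormal h.1 h.2.2.1 h.2.1.2
    have hn₁ : IsOuterNormal s₁.face s₁.edge ν c := by rw [hf₁, he₁]; exact hn
    have hn₂ : IsOuterNormal s₂.face s₂.edge ν c := by rw [hf₂, he₂]; exact hn
    have hG₁ := cos_sq_refract_of_avoids h₁ h₁' hn₁ hε hW hav₁
    have hG₂ := cos_sq_refract_of_avoids h₂ h₂' hn₂ hε hW hav₂
    rw [hf₁, hf₁'] at hG₁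
    rw [hf₂, hf₂'] at hG₂
    -- The inner ray is not assumed to avoid critical angles. Its sine lies between those of the
    -- outer rays, so its square is at most the square of one of them, and the bound is monotone in
    -- that square.
    have hG : ε ^ 2 * (T.weight s.face : ℝ) ^ 2 * (1 - dot (perp ν) (unitVec o s.pt) ^ 2) ≤
        (T.weight s'.face : ℝ) ^ 2 -
        (T.weight s.face : ℝ) ^ 2 * dot (perp ν) (unitVec o s.pt) ^ 2 := by
      have c1 := (cross_nonneg_iff hn.unit h₁.dot_unitVec_self h.dot_unitVec_self
        (h₁.dot_normal_pos hn₁) (h.dot_normal_pos hn)).1 hl₁.dir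
      have c2 := (cross_nonneg_iff hn.unit h.dot_unitVec_self h₂.dot_unitVec_self
        (h.dot_normal_pos hn) (h₂.dot_normal_pos hn₂)).1 hl₂.dir
      have hco : 0 ≤ (1 - ε ^ 2) * (T.weight s.face : ℝ) ^ 2 :=
        mul_nonneg (sub_nonneg.2 (pow_le_one₀ hε.le hε1)) (sq_nonneg _)
      generalize dot (perp ν) (unitVec o s.pt) = x at *
      generalize dot (perp ν) (unitVec o₁ s₁.pt) = x₁ at *
      generalize dot (perp ν) (unitVec o₂ s₂.pt) = x₂ at *
      rcases le_total 0 x with hx | hx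
      · have : x ^ 2 ≤ x₂ ^ 2 := by gcongr
        linarith [mul_le_mul_of_nonneg_left this hco]
      · have : x ^ 2 ≤ x₁ ^ 2 := by nlinarith
        linarith [mul_le_mul_of_nonneg_left this hco]
    obtain ⟨p, p₁, p₂, t, t₁, t₂, e, e₁, e₂, hlast, hcost₁, hcost₂⟩ :=
      ih L₁ L₂ s' s₁' s₂' s.pt s₁.pt s₂.pt (M / ε) hp hp₁ hp₂ ha₁ ha₂ hf₁' hf₂' hL₁ hL₂
        ⟨s.edge, h.2.1, hr.2.2.1, h.2.2.2.2.1, he₁ ▸ h₁.2.2.2.2.1, he₂ ▸ h₂.2.2.2.2.1⟩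
        (hl₁.refract h₁ h₁' hr₁ h h' hr hf₁.symm hf₁'.symm he₁.symm hn₁)
        (hl₂.refract h h' hr h₂ h₂' hr₂ hf₂ hf₂' he₂ hn)
        (hM₁.refract h h' hr h₁ h₁' hr₁ hf₁ hf₁' he₁ hn hε hG hG₁)
        (hM₂.refract h h' hr h₂ h₂' hr₂ hf₂ hf₂' he₂ hn hε hG hG₂)
        (by positivity)
        -- One crossing costs a factor 1 / ε in the tangent and releases one factor ε of the budget,
        -- so `M₀` stays fixed through the induction.
        (by rw [div_le_iff₀ hε, mul_assoc, ← pow_succ]; simpa using hMM)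
    refine ⟨p, p₁, p₂, t, t₁, t₂, ?_, ?_, ?_, hlast, ?_, ?_⟩
    · rw [List.getLast?_cons_cons, e]
    · rw [List.getLast?_cons_cons, e₁]
    · rw [List.getLast?_cons_cons, e₂]
    · have := cost_step h hr h₁ hf₁ he₁ hn (hdot h h₁ hM₁ hM hMM)
      rw [pathCost_cons T o s, pathCost_cons T o₁ s₁, mul_add, hf₁]
      linarith
    · have := cost_step h hr h₂ hf₂ he₂ hn (hdot h h₂ hM₂ hM hMM)
      rw [pathCost_cons T o s, pathCost_cons T o₂ s₂, mul_add, hf₂]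
      linarith

/-! ### The sign of the end term -/

namespace LastSegments

variable {T : WeightedTriangulation} {p p₁ p₂ : Plane} {t t₁ t₂ : Strike}

lemma cross_sub_nonneg (H : LastSegments T p p₁ p₂ t t₁ t₂) :
    0 ≤ cross (unitVec p t.pt) (t.pt - t₁.pt) ∧ 0 ≤ cross (unitVec p t.pt) (t₂.pt - t.pt) :=
  ⟨(H.left₁.travel H.strikes₁ H.strikes).right, (H.left₂.travel H.strikes H.strikes₂).left⟩

/-- If the three rays strike the same edge, one of the outer ones does so not beyond the inner one
in the direction of the latter. -/
lemma dot_nonpos_of_edge_eq (H : LastSegments T p p₁ p₂ t t₁ t₂) (he₁ : t₁.edge = t.edge)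
    (he₂ : t₂.edge = t.edge) :
    dot (unitVec p t.pt) (t₁.pt - t.pt) ≤ 0 ∨ dot (unitVec p t.pt) (t₂.pt - t.pt) ≤ 0 := by
  have h := H.strikes
  obtain ⟨ν, c, hn⟩ := WeightedTriangulation.exists_outerNormal h.1 h.2.2.1 h.2.1.2
  have hν := hn.unit
  have hpos := h.dot_normal_pos hn
  have m := hn.on_edge _ h.2.2.2.2.1
  have m₁ := hn.on_edge _ (he₁ ▸ H.strikes₁.2.2.2.2.1)
  have m₂ := hn.on_edge _ (he₂ ▸ H.strikes₂.2.2.2.2.1)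
  have hx : dot ν (t.pt - t₁.pt) = 0 := by rw [dot_sub_right]; linarith
  have hx₁ : dot ν (t₁.pt - t.pt) = 0 := by rw [dot_sub_right]; linarith
  have hx₂ : dot ν (t₂.pt - t.pt) = 0 := by rw [dot_sub_right]; linarith
  obtain ⟨c1, c2⟩ := H.cross_sub_nonneg
  rw [cross_eq_frame hν, hx, mul_zero, sub_zero] at c1
  rw [cross_eq_frame hν, hx₂, mul_zero, sub_zero] at c2
  replace c1 := nonneg_of_mul_nonneg_right c1 hpos
  replace c2 := nonneg_of_mul_nonneg_right c2 hpos
  rw [dot_eq_frame hν, dot_eq_frame hν _ (t₂.pt - t.pt), hx₁, hx₂, mul_zero, add_zero, add_zero]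
  have e : dot (perp ν) (t₁.pt - t.pt) = - dot (perp ν) (t.pt - t₁.pt) := by
    rw [dot_sub_right, dot_sub_right]; ring
  -- The outer end points lie on opposite sides of `t.pt` along the edge; the one against the
  -- tangential component of the inner direction is chosen.
  rcases le_total (dot (perp ν) (unitVec p t.pt)) 0 with h0 | h0
  · right; exact mul_nonpos_of_nonpos_of_nonneg h0 c2
  · left; rw [e]; exact mul_nonpos_of_nonneg_of_nonpos h0 (by linarith)

lemma exists_edge_eq_pair {a e f : Finset Plane} {v : Plane} (hf : f.card = 3) (ha : a.card = 2)
    (he : e.card = 2) (haf : a ⊆ f) (hef : e ⊆ f) (hea : e ≠ a) (hv : v ∈ f) (hva : v ∉ a) :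
    ∃ x ∈ a, e = {v, x} := by
  classical
  have hfa : f = insert v a := by
    symm
    apply Finset.eq_of_subset_of_card_le (Finset.insert_subset hv haf)
    rw [Finset.card_insert_of_notMem hva, ha, hf]
  have hve : v ∈ e := by
    by_contra hve
    apply hea
    apply Finset.eq_of_subset_of_card_le _ (by rw [ha, he])
    intro x hx
    have := hef hx
    rw [hfa, Finset.mem_insert] at this
    rcases this with rfl | h
    · exact absurd hx hve
    · exact h
  obtain ⟨x, hx⟩ : ∃ x, e.erase v = {x} := by
    rw [← Finset.card_eq_one, Finset.card_erase_of_mem hve, he]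
  have hxe : x ∈ e.erase v := by rw [hx]; exact Finset.mem_singleton_self x
  refine ⟨x, ?_, ?_⟩
  · have := hef (Finset.mem_of_mem_erase hxe)
    rw [hfa, Finset.mem_insert] at this
    exact this.resolve_left (Finset.ne_of_mem_erase hxe)
  · rw [← Finset.insert_erase hve, hx]

/-- If the inner ray strikes a vertex, then both outer rays strike edges incident to this vertex,
and one of them does so not beyond the vertex in the direction of the inner ray. -/
lemma dot_nonpos_of_vertex (H : LastSegments T p p₁ p₂ t t₁ t₂) (hv : t.pt ∈ t.face) :
    (t.pt ∈ t₁.edge ∧ t.pt ∈ t₂.edge) ∧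
    (dot (unitVec p t.pt) (t₁.pt - t.pt) ≤ 0 ∨ dot (unitVec p t.pt) (t₂.pt - t.pt) ≤ 0) := by
  have h := H.strikes
  obtain ⟨a, ha, haf, hpa, hpa₁, hpa₂⟩ := H.start
  obtain ⟨ν, c, hn⟩ := WeightedTriangulation.exists_outerNormal h.1 haf ha.2
  have hneg := h.dot_normal_neg hn hpa
  -- The ray leaves `a` strictly inwards and cannot end on it. So the struck vertex is the apex
  -- opposite `a`, and every edge of the face other than `a` contains it.
  have hva : t.pt ∉ a := by
    intro hva
    have h1 := h.dot_sub ν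
    rw [dot_sub_right, hn.on_edge _ hpa, hn.on_edge _ (subset_convexHull ℝ _ hva), sub_self] at h1
    exact (mul_neg_of_pos_of_neg h.dist_pos hneg).ne h1.symm
  have key : ∀ {p' : Plane} {t' : Strike}, Strikes T p' t' → t'.face = t.face →
      p' ∈ convexHull ℝ (a : Set Plane) → ∃ x ∈ a, t'.edge = {t.pt, x} ∧
        ∃ l : ℝ, 0 ≤ l ∧ t'.pt - t.pt = l • (x - t.pt) := by
    intro p' t' h' hf' hp'
    have hn' : IsOuterNormal t'.face a ν c := by rw [hf']; exact hn
    have hne : t'.edge ≠ a := by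
      intro hea
      have h1 := h'.dot_sub ν
      rw [dot_sub_right, hn.on_edge _ hp', hn.on_edge _ (hea ▸ h'.2.2.2.2.1), sub_self] at h1
      exact (mul_neg_of_pos_of_neg h'.dist_pos (h'.dot_normal_neg hn' hp')).ne h1.symm
    obtain ⟨x, hxa, hx⟩ := exists_edge_eq_pair h.1.2 ha.2 h'.2.1.2 haf (hf' ▸ h'.2.2.1) hne hv hva
    refine ⟨x, hxa, hx, ?_⟩
    have hpt := h'.2.2.2.2.1
    rw [hx, Finset.coe_pair, convexHull_pair] at hpt
    obtain ⟨r, l, -, hl, hrl, hpt⟩ := hpt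
    refine ⟨l, hl, ?_⟩
    rw [← hpt, show r = 1 - l by linarith]
    module
  obtain ⟨x₁, hx₁, he₁, l₁, hl₁, hpt₁⟩ := key H.strikes₁ H.face₁ hpa₁
  obtain ⟨x₂, hx₂, he₂, l₂, hl₂, hpt₂⟩ := key H.strikes₂ H.face₂ hpa₂
  refine ⟨⟨by rw [he₁]; simp, by rw [he₂]; simp⟩, ?_⟩
  by_contra! hcon
  obtain ⟨hc₁, hc₂⟩ := hcon
  obtain ⟨c1, c2⟩ := H.cross_sub_nonneg
  have hd := h.dot_unitVec_self
  have hpd := h.dot_sub (unitVec p t.pt)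
  rw [hd, mul_one] at hpd
  have hdist := h.dist_pos
  set d := unitVec p t.pt with hdd
  rw [hpt₁, dot_smul_right] at hc₁
  rw [hpt₂, dot_smul_right] at hc₂
  have hcr : cross d (t.pt - t₁.pt) = - (l₁ * cross d (x₁ - t.pt)) := by
    rw [← neg_sub t₁.pt, hpt₁]; simp [cross]; ring
  have hcr₂ : cross d (t₂.pt - t.pt) = l₂ * cross d (x₂ - t.pt) := by
    rw [hpt₂]; simp [cross]; ring
  rw [hcr] at c1
  rw [hcr₂] at c2
  have hl₁' : 0 < l₁ := hl₁.lt_of_ne (by rintro rfl; simp at hc₁)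
  have hl₂' : 0 < l₂ := hl₂.lt_of_ne (by rintro rfl; simp at hc₂)
  replace c1 : cross d (x₁ - t.pt) ≤ 0 := by
    by_contra! hlt
    linarith [mul_pos hl₁' hlt]
  replace c2 := nonneg_of_mul_nonneg_right c2 hl₂'
  replace hc₁ := pos_of_mul_pos_right hc₁ hl₁
  replace hc₂ := pos_of_mul_pos_right hc₂ hl₂
  -- Otherwise `p` lies between `x₁` and `x₂`, both strictly beyond the vertex in direction `d`,
  -- although `p` is behind it.
  have hxx : x₁ = x₂ := by
    by_contra hne
    have haeq : a = {x₁, x₂} := by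
      symm
      apply Finset.eq_of_subset_of_card_le
      · intro y hy
        simp only [Finset.mem_insert, Finset.mem_singleton] at hy
        rcases hy with rfl | rfl <;> assumption
      · rw [Finset.card_pair hne, ha.2]
    rw [haeq, Finset.coe_pair, convexHull_pair] at hpa
    obtain ⟨r, l, hr, hl, hrl, hp⟩ := hpa
    rw [← hp, dot_sub_right, dot_add_right, dot_smul_right, dot_smul_right] at hpd
    rw [dot_sub_right] at hc₁ hc₂
    rw [hp] at hpd
    have : dot d t.pt = r * dot d t.pt + l * dot d t.pt := by rw [← add_mul, hrl, one_mul]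
    have := mul_nonneg hr hc₁.le
    have := mul_nonneg hl hc₂.le
    linarith
  subst hxx
  have hcz : cross d (x₁ - t.pt) = 0 := le_antisymm c1 c2
  -- the vertex lies strictly between `p` and `x₁`
  have hpar : x₁ - t.pt = dot d (x₁ - t.pt) • d := by
    have e := eq_frame hd (x₁ - t.pt)
    have hcp : dot (perp d) (x₁ - t.pt) = cross d (x₁ - t.pt) := by simp [dot, cross, perp]; ring
    rwa [hcp, hcz, zero_smul, zero_add] at e
  -- Beyond the vertex the direction `d` leads further away from `a`, whereas `x₁` lies on `a`.
  have e1 : dot ν (x₁ - t.pt) < 0 := by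
    rw [hpar, dot_smul_right]
    exact mul_neg_of_pos_of_neg hc₁ hneg
  have e2 := hn.on_edge _ (subset_convexHull ℝ _ hx₁)
  have e3 := hn.lt_of_mem _ hv hva
  rw [dot_sub_right] at e1
  linarith

end LastSegments

/-! ### Initial parts of paths -/

section Prefixes

variable {T : WeightedTriangulation}

lemma IsRefractedPath.take {L : List Strike} : ∀ {o : Plane} (k : ℕ), IsRefractedPath T o L →
    IsRefractedPath T o (L.take k) := by
  induction L with
  | nil => intro o k _; simp [IsRefractedPath]
  | cons s L ih =>
    intro o k h
    rcases k with _ | _ | k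
    · simp [IsRefractedPath]
    · simpa [IsRefractedPath] using h.head
    · rcases L with _ | ⟨s', L⟩
      · simpa using h
      · have := ih (k + 1) h.2.2
        simp only [List.take_succ_cons, IsRefractedPath] at this ⊢
        exact ⟨h.1, h.2.1, this⟩

lemma AvoidsCritical.take {κ : ℝ} {L : List Strike} : ∀ {o : Plane} (k : ℕ),
    AvoidsCritical T κ o L → AvoidsCritical T κ o (L.take k) := by
  induction L with
  | nil => intro o k _; simp [AvoidsCritical]
  | cons s L ih =>
    intro o k h
    rcases k with _ | _ | k
    · simp [AvoidsCritical]
    · simp [AvoidsCritical]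
    · rcases L with _ | ⟨s', L⟩
      · simp [AvoidsCritical]
      · have := ih (k + 1) h.2
        simp only [List.take_succ_cons, AvoidsCritical] at this ⊢
        exact ⟨h.1, this⟩

lemma IsRefractedPath.exists_strikes_of_getLast? {L : List Strike} {t : Strike} :
    ∀ {o : Plane}, IsRefractedPath T o L → L.getLast? = some t → ∃ p, Strikes T p t := by
  induction L with
  | nil => intro o _ h; simp at h
  | cons s L ih =>
    intro o h ht
    rcases L with _ | ⟨s', L⟩
    · obtain rfl : s = t := by simpa using ht
      exact ⟨o, h⟩
    · exact ih h.2.2 (by rwa [List.getLast?_cons_cons] at ht)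

lemma pathCost_nonneg (o : Plane) (L : List Strike) : 0 ≤ pathCost T o L := by
  induction L generalizing o with
  | nil => exact le_rfl
  | cons s L ih =>
    rw [pathCost_cons]
    have := ih s.pt
    positivity

end Prefixes

/-! ### Positions and costs of sources -/

section Sources

variable {T : WeightedTriangulation} {u : Plane} {R : Source → Finset Plane} {σ : Source}

lemma IsSource.cost_nonneg (h : IsSource T u R σ) : 0 ≤ σ.cost := by
  induction h with
  | root => exact le_rfl
  | critical σ L s g _ _ _ _ _ _ _ _ _ ih => exact add_nonneg ih (pathCost_nonneg _ _)

/-- A source that lies in a triangle lies on an edge of it. -/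
lemma IsSource.exists_edge (hu : u ∈ T.verts) (h : IsSource T u R σ) {f : Finset Plane}
    (hf : f ∈ T.triangles) (hσ : σ.pt ∈ convexHull ℝ (f : Set Plane)) :
    ∃ a ∈ T.edges, a ⊆ f ∧ σ.pt ∈ convexHull ℝ (a : Set Plane) := by
  classical
  obtain ⟨t, ht, htc, hσt⟩ : ∃ t ∈ T.faces, t.card ≤ 2 ∧ σ.pt ∈ convexHull ℝ (t : Set Plane) := by
    cases h with
    | root => exact ⟨{u}, hu, by simp, by simp⟩
    | critical σ L s g hσ hray hdir hpt hg hne he hw hcrit =>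
      obtain ⟨x, y, hxy, hs, hpt⟩ := hpt
      refine ⟨s.edge, T.down_closed hg.1 he ⟨x, by rw [hs]; simp⟩, ?_, ?_⟩
      · rw [hs, Finset.card_pair hxy]
      · rw [hs, Finset.coe_pair, convexHull_pair]
        exact openSegment_subset_segment ℝ x y hpt
  -- The source lies on a vertex or edge `t`, hence on the common face of `t` and `f`; its at most
  -- two vertices are completed to an edge of `f`.
  have hmem := T.inter_subset_convexHull ht hf.1 ⟨hσt, hσ⟩
  obtain ⟨a, h1, h2, h3⟩ := Finset.exists_subsuperset_card_eq
    (Finset.inter_subset_right : t ∩ f ⊆ f)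
    ((Finset.card_le_card Finset.inter_subset_left).trans htc) (by rw [hf.2]; norm_num)
  refine ⟨a, ⟨T.down_closed hf.1 h2 (Finset.card_pos.1 (by omega)), h3⟩, h2, ?_⟩
  refine convexHull_mono ?_ hmem
  rw [← Finset.coe_inter]
  exact_mod_cast h1

end Sources

/-! ### Bounds on the constants -/

section Constants

variable {T : WeightedTriangulation}

lemma WeightedTriangulation.finite_triangles (T : WeightedTriangulation) : T.triangles.Finite :=
  T.finite_faces.subset fun _ h => h.1

lemma WeightedTriangulation.weight_le_wMax {f : Finset Plane} (hf : f ∈ T.triangles) :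
    T.weight f ≤ T.wMax :=
  le_csSup (T.finite_triangles.image _).bddAbove ⟨f, hf, rfl⟩

lemma WeightedTriangulation.one_le_mu {f : Finset Plane} (hf : f ∈ T.triangles) : 1 ≤ T.mu := by
  obtain ⟨g, hg, hgw⟩ := Nat.sInf_mem (s := T.weight '' T.triangles) ⟨_, f, hf, rfl⟩
  have hg1 : 0 < T.wMin := by
    rw [wMin, ← hgw]; exact T.weight_pos g hg.1 hg.2
  have hle : T.wMin ≤ T.wMax := by
    rw [wMin, ← hgw]; exact weight_le_wMax hg
  rw [mu, one_le_div (by exact_mod_cast hg1)]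
  exact_mod_cast hle

lemma WeightedTriangulation.two_le_eta (T : WeightedTriangulation) : 2 ≤ T.eta := by
  have hle : ∀ θ ∈ ({0} ∪ {θ | ∃ f ∈ T.triangles, ∃ g ∈ T.triangles, ∃ e ∈ T.edges, e ⊆ f ∧ e ⊆ g ∧
      T.weight g < T.weight f ∧ θ = T.criticalAngle f g} : Set ℝ), θ ≤ Real.pi / 2 := by
    rintro θ (rfl | ⟨f, -, g, -, e, -, -, -, -, rfl⟩)
    · positivity
    · exact Real.arcsin_le_pi_div_two _
  have h1 : T.maxCriticalAngle ≤ Real.pi / 2 := csSup_le ⟨0, by simp⟩ hle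
  have h0 : 0 ≤ T.maxCriticalAngle := le_csSup ⟨_, hle⟩ (by simp)
  have := Real.cos_nonneg_of_neg_pi_div_two_le_of_le (by linarith [Real.pi_pos]) h1
  have h2 : 0 ≤ 1 / Real.cos T.maxCriticalAngle := by positivity
  rw [eta]
  linarith

/-- The bound on ε loses only the factors l_min / l_max ≤ 1 and 1 / n ≤ 1. With it, the sine of
every critical angle is at least 4ε, as the estimate near that angle requires. -/
lemma WeightedTriangulation.four_mul_weight_le_one {ε : ℝ} (hε : 0 < ε)
    (h : ε ≤ T.lMin / (4 * T.n * T.wMax * T.lMax)) {f : Finset Plane} (hf : f ∈ T.triangles) :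
    4 * ε * T.weight f ≤ 1 := by
  have hnn : ∀ l ∈ T.edgeLengths, 0 ≤ l := by
    rintro l ⟨a, b, -, -, rfl⟩; exact dist_nonneg
  have hl0 : 0 ≤ T.lMax := Real.sSup_nonneg hnn
  -- A vanishing denominator would make the quotient 0, against ε > 0.
  have hA : 0 < 4 * (T.n : ℝ) * T.wMax * T.lMax := by
    apply lt_of_le_of_ne (by positivity)
    intro h0
    rw [← h0, div_zero] at h
    linarith
  have hl : T.lMax ≠ 0 := right_ne_zero_of_mul hA.ne'
  have hn : (T.n : ℝ) ≠ 0 := by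
    intro h0; rw [h0] at hA; simp at hA
  have hn1 : (1 : ℝ) ≤ T.n := by
    have : T.n ≠ 0 := by exact_mod_cast hn
    exact_mod_cast Nat.one_le_iff_ne_zero.2 this
  have hle : T.lMin ≤ T.lMax := by
    have hne : T.edgeLengths.Nonempty := by
      by_contra hcon
      rw [Set.not_nonempty_iff_eq_empty] at hcon
      exact hl (by rw [lMax, hcon, Real.sSup_empty])
    -- The supremum of an unbounded set of reals is 0 by convention, which `hl` excludes.
    have hbdd : BddAbove T.edgeLengths := by
      by_contra hcon
      exact hl (Real.sSup_of_not_bddAbove hcon)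
    obtain ⟨l, hlm⟩ := hne
    exact (csInf_le ⟨0, hnn⟩ hlm).trans (le_csSup hbdd hlm)
  rw [le_div_iff₀ hA] at h
  have hlpos : 0 < T.lMax := hl0.lt_of_ne hl.symm
  have h1 : ε * (4 * T.n * T.wMax) ≤ 1 := by
    refine le_of_mul_le_mul_right ?_ hlpos
    calc _ = ε * (4 * T.n * T.wMax * T.lMax) := by ring
      _ ≤ 1 * T.lMax := by linarith
  have hw : (T.weight f : ℝ) ≤ T.wMax := by exact_mod_cast weight_le_wMax hf
  calc 4 * ε * T.weight f ≤ 4 * ε * T.wMax := by gcongr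
    _ = 1 * (4 * ε * T.wMax) := by ring
    _ ≤ T.n * (4 * ε * T.wMax) := by gcongr
    _ = ε * (4 * T.n * T.wMax) := by ring
    _ ≤ 1 := h1

end Constants

/-! ### Directions between two given ones -/

section Cone

variable {d d₁ d₂ : Plane}

/-- With c = d₁ · d₂ and d = a d₁ + b d₂ of norm one, (d · d₁)² - c² = (1 - b²)(1 - c²), and c ≥ 0
forces b ≤ 1. -/
lemma dot_le_dot_of_mem_cone (hd : dot d d = 1) (hd₁ : dot d₁ d₁ = 1) (hd₂ : dot d₂ d₂ = 1)
    (h0 : 0 ≤ dot d₁ d₂) (h : d ∈ cone d₁ d₂) : dot d₁ d₂ ≤ dot d d₁ := by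
  obtain ⟨a, b, ha, hb, rfl⟩ := h
  have hc1 := dot_le_one hd₁ hd₂
  have e1 : dot (a • d₁ + b • d₂) d₁ = a + b * dot d₁ d₂ := by
    rw [dot_comm, dot_add_right, dot_smul_right, dot_smul_right, hd₁, mul_one]
  have e2 : dot (a • d₁ + b • d₂) (a • d₁ + b • d₂) = a ^ 2 + b ^ 2 + 2 * a * b * dot d₁ d₂ := by
    rw [dot_add_right, dot_smul_right, dot_smul_right, e1,
      dot_comm (a • d₁ + b • d₂) d₂, dot_add_right, dot_smul_right, dot_smul_right, hd₂,
      dot_comm d₂ d₁]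
    ring
  rw [e2] at hd
  rw [e1]
  generalize dot d₁ d₂ = c at *
  have hb1 : b ^ 2 ≤ 1 := by
    have : 0 ≤ 2 * a * b * c := by positivity
    linarith [sq_nonneg a]
  have hcc : c ^ 2 ≤ 1 := pow_le_one₀ h0 hc1
  apply le_of_sq_le_sq _ (by positivity)
  have := mul_nonneg (sub_nonneg.2 hb1) (sub_nonneg.2 hcc)
  linarith

lemma cone_comm : cone d₁ d₂ = cone d₂ d₁ := by
  ext x
  constructor <;> (rintro ⟨a, b, ha, hb, rfl⟩; exact ⟨b, a, hb, ha, add_comm _ _⟩)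

lemma cross_nonneg_of_mem_cone (h12 : 0 ≤ cross d₁ d₂) (h : d ∈ cone d₁ d₂) :
    0 ≤ cross d₁ d ∧ 0 ≤ cross d d₂ := by
  obtain ⟨a, b, ha, hb, rfl⟩ := h
  constructor
  · rw [show cross d₁ (a • d₁ + b • d₂) = b * cross d₁ d₂ by simp [cross]; ring]
    exact mul_nonneg hb h12
  · rw [show cross (a • d₁ + b • d₂) d₂ = a * cross d₁ d₂ by simp [cross]; ring]
    exact mul_nonneg ha h12

end Cone

/-! ### Assembly of the estimate -/

/-- Of three rays from one point on an edge that traverse the same faces, where the inner one lies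
between the outer ones, one of the outer ones is not much longer than the inner one. -/
lemma exists_pathCost_le {T : WeightedTriangulation} {ε δ M₀ : ℝ} (hε : 0 < ε) (hε1 : ε ≤ 1)
    (hW : ∀ f ∈ T.triangles, 4 * ε * T.weight f ≤ 1) {o : Plane} {P P₁ P₂ : List Strike}
    {s s₁ s₂ : Strike}
    (hp : IsRefractedPath T o (s :: P)) (hp₁ : IsRefractedPath T o (s₁ :: P₁))
    (hp₂ : IsRefractedPath T o (s₂ :: P₂))
    (ha₁ : AvoidsCritical T ε o (s₁ :: P₁)) (ha₂ : AvoidsCritical T ε o (s₂ :: P₂))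
    (hf₁ : (s₁ :: P₁).map Strike.face = (s :: P).map Strike.face)
    (hf₂ : (s₂ :: P₂).map Strike.face = (s :: P).map Strike.face)
    (ho : ∃ a ∈ T.edges, a ⊆ s.face ∧ o ∈ convexHull ℝ (a : Set Plane))
    (hcone : unitVec o s.pt ∈ cone (unitVec o s₁.pt) (unitVec o s₂.pt))
    (hδ : 0 ≤ δ) (hδ1 : δ ≤ 1) (hδM : δ ≤ M₀ * ε ^ P.length)
    (hangle : InnerProductGeometry.angle (unitVec o s₁.pt) (unitVec o s₂.pt) ≤ δ) :
    ∃ t t₁ t₂, (s :: P).getLast? = some t ∧ (s₁ :: P₁).getLast? = some t₁ ∧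
      (s₂ :: P₂).getLast? = some t₂ ∧ (∃ p₁, Strikes T p₁ t₁) ∧ (∃ p₂, Strikes T p₂ t₂) ∧
      (t.pt ∈ t.face → t.pt ∈ t₁.edge ∧ t.pt ∈ t₂.edge) ∧
      (t₁.edge = t.edge ∧ t₂.edge = t.edge ∨ t.pt ∈ t.face →
        (1 - 2 * M₀ ^ 2) * pathCost T o (s₁ :: P₁) ≤ pathCost T o (s :: P) ∨
        (1 - 2 * M₀ ^ 2) * pathCost T o (s₂ :: P₂) ≤ pathCost T o (s :: P)) := by
  -- Hypotheses and conclusion are symmetric in the outer rays, so they may be named with the first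
  -- on the right.
  wlog horient : 0 ≤ cross (unitVec o s₁.pt) (unitVec o s₂.pt) generalizing P₁ P₂ s₁ s₂
  · have hanti : ∀ x y, cross x y = - cross y x := fun x y => by simp [cross]; ring
    rw [hanti] at horient
    obtain ⟨t, t₂, t₁, e, e₂, e₁, h₂, h₁, hv, hc⟩ := this hp₂ hp₁ ha₂ ha₁ hf₂ hf₁
      (cone_comm ▸ hcone) (by rwa [InnerProductGeometry.angle_comm]) (by linarith)
    exact ⟨t, t₁, t₂, e, e₁, e₂, h₁, h₂, fun h => (hv h).symm,
      fun h => (hc (h.imp_left And.symm)).symm⟩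
  have hd := hp.head.dot_unitVec_self
  have hd₁ := hp₁.head.dot_unitVec_self
  have hd₂ := hp₂.head.dot_unitVec_self
  have hn : ∀ {x : Plane}, dot x x = 1 → ‖x‖ = 1 := by
    intro x hx
    have := norm_sq_eq_dot x
    rw [hx] at this
    exact (pow_eq_one_iff_of_nonneg (norm_nonneg _) two_ne_zero).1 this
  have hcos : 1 - δ ^ 2 / 2 ≤ dot (unitVec o s₁.pt) (unitVec o s₂.pt) := by
    have h1 := InnerProductGeometry.cos_angle (unitVec o s₁.pt) (unitVec o s₂.pt)
    rw [hn hd₁, hn hd₂, mul_one, div_one, inner_eq_dot] at h1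
    rw [← h1]
    refine le_trans ?_ Real.one_sub_sq_div_two_le_cos
    have h0 := InnerProductGeometry.angle_nonneg (unitVec o s₁.pt) (unitVec o s₂.pt)
    have : InnerProductGeometry.angle (unitVec o s₁.pt) (unitVec o s₂.pt) ^ 2 ≤ δ ^ 2 := by gcongr
    linarith
  have hδ2 : δ ^ 2 ≤ 1 := pow_le_one₀ hδ hδ1
  -- With δ ≤ 1 the cosine is at least 1 / 2, so 1 - cos ≤ δ² / 2 ≤ δ²(1 + cos): the angle bound
  -- itself serves as a bound for the half-angle tangent.
  have hclose : ∀ {x : Plane}, dot (unitVec o s₁.pt) (unitVec o s₂.pt) ≤ dot (unitVec o s.pt) x →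
      HalfAngleLE δ (unitVec o s.pt) x := by
    intro x hx
    have : δ ^ 2 * 1 ≤ δ ^ 2 * (1 + dot (unitVec o s.pt) x) :=
      mul_le_mul_of_nonneg_left (by linarith) (sq_nonneg δ)
    unfold HalfAngleLE
    linarith [sq_nonneg δ]
  obtain ⟨hl₁, hl₂⟩ := cross_nonneg_of_mem_cone horient hcone
  have hz : ∀ x, cross x (o - o) = 0 := fun x => by simp [cross]
  have hz' : ∀ x, dot x (o - o) = 0 := fun x => by simp [dot]
  obtain ⟨a, ha, haf, hoa⟩ := ho
  simp only [List.map_cons, List.cons.injEq] at hf₁ hf₂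
  obtain ⟨p, p₁, p₂, t, t₁, t₂, e, e₁, e₂, H, hc₁, hc₂⟩ := exists_lastSegments hε hε1 hW P P₁ P₂ s s₁
    s₂ o o o δ hp hp₁ hp₂ ha₁ ha₂ hf₁.1 hf₂.1 hf₁.2 hf₂.2 ⟨a, ha, haf, hoa, hoa, hoa⟩
    ⟨hl₁, (hz _).ge, (hz _).ge⟩ ⟨hl₂, (hz _).ge, (hz _).ge⟩
    (hclose (dot_le_dot_of_mem_cone hd hd₁ hd₂ (by linarith) hcone))
    (hclose (dot_comm (unitVec o s₂.pt) _ ▸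
      dot_le_dot_of_mem_cone hd hd₂ hd₁ (by rw [dot_comm]; linarith) (cone_comm ▸ hcone)))
    hδ hδM
  -- The common source makes the initial boundary terms vanish.
  rw [hz', mul_zero, sub_zero] at hc₁ hc₂
  have w := zero_le_one.trans (weight_pos_of_mem H.strikes.1)
  refine ⟨t, t₁, t₂, e, e₁, e₂, ⟨p₁, H.strikes₁⟩, ⟨p₂, H.strikes₂⟩,
    fun hv => (H.dot_nonpos_of_vertex hv).1, fun h => ?_⟩
  have hdot : dot (unitVec p t.pt) (t₁.pt - t.pt) ≤ 0 ∨ dot (unitVec p t.pt) (t₂.pt - t.pt) ≤ 0 := by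
    rcases h with ⟨h₁, h₂⟩ | hv
    · exact H.dot_nonpos_of_edge_eq h₁ h₂
    · exact (H.dot_nonpos_of_vertex hv).2
  rcases hdot with hdot | hdot
  · left; linarith [mul_nonpos_of_nonneg_of_nonpos w hdot]
  · right; linarith [mul_nonpos_of_nonneg_of_nonpos w hdot]

/-- If two rays that keep off critical angles and include a small angle begin by traversing the faces
of a Type-I ray `r` between them, the part of one of them in these faces is not much longer
than `r`. -/
lemma exists_prefix_cost_le {T : WeightedTriangulation} {u : Plane} (hu : u ∈ T.verts)
    {R : Source → Finset Plane} {ε' : ℝ} (hε' : 0 < ε')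
    (hε'_le : ε' ≤ T.lMin / (4 * T.n * T.wMax * T.lMax)) {r ρ₁ ρ₂ : Ray}
    (hr : IsTypeIRay T u R r) (hρ₁ : IsTypeIRay T u R ρ₁) (hρ₂ : IsTypeIRay T u R ρ₂)
    (hlen : ρ₁.edgeSeq.length ≤ T.n ^ 2)
    (ha₁ : AvoidsCritical T ε' ρ₁.source.pt ρ₁.path)
    (ha₂ : AvoidsCritical T ε' ρ₂.source.pt ρ₂.path)
    (hangle : InnerProductGeometry.angle ρ₁.dir ρ₂.dir ≤
      1 / (2 * T.mu) * ε' ^ (T.n ^ 2) * ε')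
    (hb : LiesBetween ρ₁ ρ₂ r)
    (hf₁ : r.faceSeq <+: ρ₁.faceSeq) (hf₂ : r.faceSeq <+: ρ₂.faceSeq) {t : Strike}
    (ht : r.path.getLast? = some t) :
    ∃ t₁ t₂, (ρ₁.path.take r.path.length).getLast? = some t₁ ∧
      (ρ₂.path.take r.path.length).getLast? = some t₂ ∧
      (∃ p₁, Strikes T p₁ t₁) ∧ (∃ p₂, Strikes T p₂ t₂) ∧
      (t.pt ∈ t.face → t.pt ∈ t₁.edge ∧ t.pt ∈ t₂.edge) ∧
      (t₁.edge = t.edge ∧ t₂.edge = t.edge ∨ t.pt ∈ t.face →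
        (Ray.mk ρ₁.source (ρ₁.path.take r.path.length)).cost T ≤ r.cost T * (1 + T.eta * ε') ∨
        (Ray.mk ρ₂.source (ρ₂.path.take r.path.length)).cost T ≤ r.cost T * (1 + T.eta * ε')) := by
  obtain ⟨σ, path⟩ := r
  obtain ⟨σ₁, path₁⟩ := ρ₁
  obtain ⟨σ₂, path₂⟩ := ρ₂
  obtain ⟨hσ₁, hσ₂, hcone⟩ := hb
  dsimp only at hσ₁ hσ₂
  subst hσ₁ hσ₂
  obtain ⟨hsrc, -, hne, hp, -⟩ := hr
  obtain ⟨-, -, hne₁, hp₁, -⟩ := hρ₁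
  obtain ⟨-, -, hne₂, hp₂, -⟩ := hρ₂
  dsimp only at *
  obtain ⟨s, P, rfl⟩ := List.exists_cons_of_ne_nil hne
  obtain ⟨s₁, P₁, rfl⟩ := List.exists_cons_of_ne_nil hne₁
  obtain ⟨s₂, P₂, rfl⟩ := List.exists_cons_of_ne_nil hne₂
  rw [List.prefix_iff_eq_take] at hf₁ hf₂
  simp only [Ray.faceSeq, List.length_map, ← List.map_take] at hf₁ hf₂
  have hW : ∀ f ∈ T.triangles, 4 * ε' * T.weight f ≤ 1 := fun f hf =>
    WeightedTriangulation.four_mul_weight_le_one hε' hε'_le hf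
  have hs := hp.head
  have hε1 : ε' ≤ 1 := by
    have h1 := hW _ hs.1
    have h2 := weight_pos_of_mem hs.1
    nlinarith
  have hμ := WeightedTriangulation.one_le_mu hs.1
  -- The last struck edge is not crossed, so `P.length` counts exactly the crossings of `r`.
  have hcount : P.length ≤ T.n ^ 2 := by
    have h1 := congrArg List.length hf₁
    simp only [List.length_map, List.length_take, List.length_cons] at h1
    simp only [Ray.edgeSeq, List.length_map, List.length_dropLast, List.length_cons] at hlen
    omega
  -- Only μ ≥ 1 is needed. The final tangent bound is `M₀` = ε' / 2, hence the factor 1 - ε'² / 2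
  -- below.
  have hδM : 1 / (2 * T.mu) * ε' ^ (T.n ^ 2) * ε' ≤ ε' / 2 * ε' ^ P.length := by
    have h1 : 1 / (2 * T.mu) ≤ 1 / 2 := by
      apply one_div_le_one_div_of_le <;> linarith
    have h2 : ε' ^ (T.n ^ 2) ≤ ε' ^ P.length := pow_le_pow_of_le_one hε'.le hε1 hcount
    calc _ ≤ 1 / 2 * ε' ^ P.length * ε' := by gcongr
      _ = _ := by ring
  have hδ0 : 0 ≤ 1 / (2 * T.mu) * ε' ^ (T.n ^ 2) * ε' := by positivity
  have hδ1 : 1 / (2 * T.mu) * ε' ^ (T.n ^ 2) * ε' ≤ 1 := by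
    have h1 : ε' ^ P.length ≤ 1 := pow_le_one₀ hε'.le hε1
    have h2 : ε' / 2 * ε' ^ P.length ≤ ε' / 2 * 1 := by gcongr
    linarith
  obtain ⟨t', t₁, t₂, e, e₁, e₂, h₁, h₂, hv, hc⟩ := exists_pathCost_le hε' hε1 hW hp
    (hp₁.take (P.length + 1)) (hp₂.take (P.length + 1)) (ha₁.take (P.length + 1))
    (ha₂.take (P.length + 1)) hf₁.symm hf₂.symm (hsrc.exists_edge hu hs.1 hs.2.2.2.1) hcone
    hδ0 hδ1 hδM hangle
  obtain rfl : t' = t := Option.some.inj (e.symm.trans ht)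
  refine ⟨t₁, t₂, e₁, e₂, h₁, h₂, hv, fun h => ?_⟩
  have hfin : ∀ Q : List Strike, (1 - 2 * (ε' / 2) ^ 2) * pathCost T σ.pt Q ≤
      pathCost T σ.pt (s :: P) → σ.cost + pathCost T σ.pt Q ≤
        (σ.cost + pathCost T σ.pt (s :: P)) * (1 + T.eta * ε') := by
    intro Q hQ
    have c0 := hsrc.cost_nonneg
    have c1 := pathCost_nonneg (T := T) σ.pt Q
    have c2 := pathCost_nonneg (T := T) σ.pt (s :: P)
    have hη := T.two_le_eta
    generalize pathCost T σ.pt Q = C at *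
    generalize pathCost T σ.pt (s :: P) = D at *
    -- The cost of the common source enters both sides and only improves the ratio.
    have h1 : (1 - ε' ^ 2 / 2) * (σ.cost + C) ≤ σ.cost + D := by
      have : 0 ≤ ε' ^ 2 / 2 * σ.cost := by positivity
      linarith
    have h2 : 1 ≤ (1 - ε' ^ 2 / 2) * (1 + 2 * ε') := by nlinarith [mul_pos hε' hε']
    calc σ.cost + C = 1 * (σ.cost + C) := (one_mul _).symm
      _ ≤ ((1 - ε' ^ 2 / 2) * (1 + 2 * ε')) * (σ.cost + C) := by gcongr
      _ = ((1 - ε' ^ 2 / 2) * (σ.cost + C)) * (1 + 2 * ε') := by ring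
      _ ≤ (σ.cost + D) * (1 + 2 * ε') := by gcongr
      _ ≤ (σ.cost + D) * (1 + T.eta * ε') := by gcongr
  exact (hc h).imp (hfin _) (hfin _)

lemma incidentAt_take {T : WeightedTriangulation} {r ρ : Ray} {t : Strike}
    (hf : r.faceSeq <+: ρ.faceSeq) (ht : (ρ.path.take r.path.length).getLast? = some t) :
    ρ.IncidentAt T r.faceSeq t.edge t.pt
      ((Ray.mk ρ.source (ρ.path.take r.path.length)).cost T) := by
  rw [List.prefix_iff_eq_take] at hf
  simp only [Ray.faceSeq, List.length_map, ← List.map_take] at hf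
  obtain ⟨L, hL⟩ := List.getLast?_eq_some_iff.1 ht
  exact ⟨_, List.take_prefix _ _, hf.symm, ⟨L, t, hL, rfl, rfl⟩, rfl⟩

theorem mainTheorem5 (T : WeightedTriangulation) (u : Plane) (hu : u ∈ T.verts)
    (R : Source → Finset Plane) (ε' : ℝ) (hε'_pos : 0 < ε')
    (hε'_le : ε' ≤ T.lMin / (4 * T.n * T.wMax * T.lMax))
    (B : Set Ray) (hB : IsRayBundle T u R B)
    (hlen : ∀ ρ ∈ B, ρ.edgeSeq.length ≤ T.n ^ 2)
    (hcrit : ∀ ρ ∈ B, AvoidsCritical T ε' ρ.source.pt ρ.path)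
    (hangle : ∀ ρ₁ ∈ B, ∀ ρ₂ ∈ B, Successive R ρ₁ ρ₂ →
      InnerProductGeometry.angle ρ₁.dir ρ₂.dir ≤ 1 / (2 * T.mu) * ε' ^ (T.n ^ 2) * ε') :
    -- `v` is a point of an edge `e` that is not a vertex
    (∀ (r : Ray) (e : Finset Plane) (v : Plane), IsTypeIRay T u R r → r.EndsAt e v →
      v ∉ T.verts →
      (∃ ρ₁ ∈ B, ∃ ρ₂ ∈ B, Successive R ρ₁ ρ₂ ∧ LiesBetween ρ₁ ρ₂ r ∧
        r.track <+: ρ₁.track ∧ r.track <+: ρ₂.track) →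
      ∃ ρ ∈ B, ∃ v' ∈ convexHull ℝ (e : Set Plane), ∃ d : ℝ,
        ρ.IncidentAt T r.faceSeq e v' d ∧ d ≤ r.cost T * (1 + T.eta * ε')) ∧
    -- `v` is a vertex
    (∀ (r : Ray) (e : Finset Plane) (v : Plane), IsTypeIRay T u R r → r.EndsAt e v →
      v ∈ T.verts →
      (∃ ρ₁ ∈ B, ∃ ρ₂ ∈ B, Successive R ρ₁ ρ₂ ∧ LiesBetween ρ₁ ρ₂ r ∧
        r.faceSeq <+: ρ₁.faceSeq ∧ r.faceSeq <+: ρ₂.faceSeq) →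
      ∃ ρ ∈ B, ∃ e' ∈ T.edges, v ∈ e' ∧ ∃ v' ∈ convexHull ℝ (e' : Set Plane), ∃ d : ℝ,
        ρ.IncidentAt T r.faceSeq e' v' d ∧ d ≤ r.cost T * (1 + T.eta * ε')) := by
  have hface : ∀ {r ρ : Ray}, r.track <+: ρ.track → r.faceSeq <+: ρ.faceSeq := by
    intro r ρ h
    have := h.map Prod.fst
    rwa [Ray.track, Ray.track, List.map_map, List.map_map] at this
  refine ⟨?_, ?_⟩
  · rintro r e v hr ⟨L, t, hL, rfl, rfl⟩ - ⟨ρ₁, hρ₁, ρ₂, hρ₂, hsucc, hbetw, ht₁, ht₂⟩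
    have hlast : r.path.getLast? = some t := List.getLast?_eq_some_iff.2 ⟨L, hL⟩
    obtain ⟨t₁, t₂, e₁, e₂, ⟨p₁, h₁⟩, ⟨p₂, h₂⟩, -, hc⟩ := exists_prefix_cost_le hu hε'_pos hε'_le hr
      (hB.1 ρ₁ hρ₁).1 (hB.1 ρ₂ hρ₂).1 (hlen ρ₁ hρ₁) (hcrit ρ₁ hρ₁) (hcrit ρ₂ hρ₂)
      (hangle ρ₁ hρ₁ ρ₂ hρ₂ hsucc) hbetw (hface ht₁) (hface ht₂) hlast
    have hedge : ∀ {ρ : Ray} {t' : Strike}, r.track <+: ρ.track →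
        (ρ.path.take r.path.length).getLast? = some t' → t'.edge = t.edge := by
      intro ρ t' h ht'
      rw [List.prefix_iff_eq_take] at h
      simp only [Ray.track, List.length_map, ← List.map_take] at h
      have := congrArg List.getLast? h
      rw [List.getLast?_map, List.getLast?_map, hlast, ht'] at this
      simp only [Option.map_some, Option.some.injEq, Prod.mk.injEq] at this
      exact this.2.symm
    have he₁ := hedge ht₁ e₁
    have he₂ := hedge ht₂ e₂
    rcases hc (Or.inl ⟨he₁, he₂⟩) with hc | hc
    · exact ⟨ρ₁, hρ₁, t₁.pt, he₁ ▸ h₁.2.2.2.2.1, _, he₁ ▸ incidentAt_take (hface ht₁) e₁, hc⟩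
    · exact ⟨ρ₂, hρ₂, t₂.pt, he₂ ▸ h₂.2.2.2.2.1, _, he₂ ▸ incidentAt_take (hface ht₂) e₂, hc⟩
  · rintro r e v hr ⟨L, t, hL, rfl, rfl⟩ hv ⟨ρ₁, hρ₁, ρ₂, hρ₂, hsucc, hbetw, ht₁, ht₂⟩
    have hlast : r.path.getLast? = some t := List.getLast?_eq_some_iff.2 ⟨L, hL⟩
    obtain ⟨t₁, t₂, e₁, e₂, ⟨p₁, h₁⟩, ⟨p₂, h₂⟩, hve, hc⟩ := exists_prefix_cost_le hu hε'_pos hε'_le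
      hr (hB.1 ρ₁ hρ₁).1 (hB.1 ρ₂ hρ₂).1 (hlen ρ₁ hρ₁) (hcrit ρ₁ hρ₁) (hcrit ρ₂ hρ₂)
      (hangle ρ₁ hρ₁ ρ₂ hρ₂ hsucc) hbetw ht₁ ht₂ hlast
    obtain ⟨p, ht⟩ := hr.2.2.2.1.exists_strikes_of_getLast? hlast
    -- A vertex of the complex lying in a closed triangle is a vertex of that triangle, as the two
    -- faces meet in a common face.
    have hvf : t.pt ∈ t.face := by
      have hmem : t.pt ∈ convexHull ℝ (t.face : Set Plane) :=
        convexHull_mono (by exact_mod_cast ht.2.2.1) ht.2.2.2.2.1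
      have := T.inter_subset_convexHull hv ht.1.1 ⟨by simp, hmem⟩
      obtain ⟨x, hx⟩ := convexHull_nonempty_iff.1 ⟨_, this⟩
      rw [Finset.coe_singleton] at hx
      exact (Set.mem_singleton_iff.1 hx.1) ▸ hx.2
    rcases hc (Or.inr hvf) with hc | hc
    · exact ⟨ρ₁, hρ₁, t₁.edge, h₁.2.1, (hve hvf).1, t₁.pt, h₁.2.2.2.2.1, _,
        incidentAt_take ht₁ e₁, hc⟩
    · exact ⟨ρ₂, hρ₂, t₂.edge, h₂.2.1, (hve hvf).2, t₂.pt, h₂.2.2.2.2.1, _,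
        incidentAt_take ht₂ e₂, hc⟩
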